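/- Let $\ell\ge 1$ and $n\ge 0$ be integers and let $0<p\le (2^7\ell)^{-\ell}$. Let $\alpha=\alpha(n,p)$ be $2^6(\log n)/p$, rounded up to an even integer, that is $\alpha = 2\lceil 2^5(\log n)/p\rceil$ (with $\log$ the natural logarithm and $\log 0:=0$). All graphs have vertex set contained in $[n]$. For an oriented graph $\vec G$ let $\vec G\setminus X=\vec G[V(\vec G)\setminus X]$, and let $\vec G^{\,r}$ be the digraph containing the edge $(u,v)$ precisely when $\vec G$ contains a directed path with $r$ edges from $u$ to $v$. For disjoint sets $S,T$ let $\overleftrightarrow{e}_{\vec D}(S,T)$ be the number of edges of the digraph $\vec D$ between $S$ and $T$, in either direction, and write $\overleftrightarrow{d}_{\vec D}(a,T)=\overleftrightarrow{e}_{\vec D}(\{a\},T)$. For $1\le r\le \ell$, $\vec G$ is *$r$-locally dense* if for all pairwise disjoint $A',B,X\subseteq V(\vec G)$ with $|A'|=\alpha$, $r\alpha\le |B|\le \ell\alpha$ and $|X|\le(\ell+1-r)\alpha$ we have $$\overleftrightarrow{e}_{(\vec G\setminus X)^r}(A',B)\ \ge\ \tfrac12\, p^{\frac{\ell-r+1}{\ell}}|A'||B|.$$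 Given a graph $G$ and an orientation $\vec H$ of an induced subgraph $H$ of $G$, let $\mathcal D_r(G,\vec H)$ be the set of all orientations $\vec G$ of $G$ that extend $\vec H$ (i.e. $E(\vec H)\subseteq E(\vec G)$), contain no directed cycle of length $\ell+2$, and are both $1$-locally dense and $r$-locally dense; write $\mathcal D_r(G)=\mathcal D_r(G,\emptyset)$. For a graph $H$, a set $A\subseteq[n]\setminus V(H)$ and disjoint $B,X\subseteq V(H)$, the quadruple $(A,H,B,X)$ is an *$r$-frame* if $|A|=\alpha/2$, $r\alpha\le|B|\le\ell\alpha$ and $|X|\le(\ell+1-r)\alpha$. For an $r$-frame, an orientation $\vec H$ of $H$, and a graph $G$ with $V(G)=A\cup V(H)$, $A=V(G)\setminus V(H)$, let $\mathcal S_r(G,\vec H,B,X)$ be the set of all orientations $\vec G$ of $G$ that extend $\vec H$ and satisfy $\overleftrightarrow{d}_{(\vec G\setminus X)^r}(a,B)\le p^{\frac{\ell-r+1}{\ell}}|B|$ for every $a\in A$. Finally, $G(A,H,p)$ is the random graph $G$ on $A\cup V(H)$ with $G[V(H)]=H$ in which each pair of distinct vertices not contained in $V(H)$ is an edge independently with probability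 $p$. **Lemma.** Let $\vec H$ be an oriented graph with underlying graph $H$, $V(H)\subseteq[n]$, let $A\subseteq[n]\setminus V(H)$ have size $\alpha/2$, and let $G=G(A,H,p)$. (i) If $2\le r\le\ell$ and $B,X\subseteq V(H)$ are such that $(A,H,B,X)$ is an $r$-frame, then $$\mathbb E\Big[\big|\mathcal D_{r-1}(G)\cap\mathcal S_r(G,\vec H,B,X)\big|\Big]\le \exp\big(9\alpha\, p^{-1/\ell}\log n\big).$$ (ii) $$\mathbb E\Big[\big|\mathcal D_\ell(G,\vec H)\big|\Big]\le\exp\big(\alpha(\ell+2)\,p^{-1/\ell}(\log n)^2\big).$$ -/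

import Mathlib

/-! Graphs and oriented graphs whose vertex set is a finite subset of an ambient set `V`
(below `V = Fin n` plays the role of `[n]`). -/

/-- A finite simple graph with vertex set `verts ⊆ V`. -/
@[ext]
structure FinGraph (V : Type*) where
  verts : Finset V
  Adj : V → V → Prop
  mem_verts : ∀ u v, Adj u v → u ∈ verts ∧ v ∈ verts
  symm : ∀ u v, Adj u v → Adj v u
  loopless : ∀ v, ¬ Adj v v

/-- An oriented graph with vertex set `verts ⊆ V`: no loops and at most one of the arcs
`uv`, `vu` is present (asymmetry includes the absence of loops). -/
@[ext]
structure OrientedGraph (V : Type*) where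
  verts : Finset V
  Adj : V → V → Prop
  mem_verts : ∀ u v, Adj u v → u ∈ verts ∧ v ∈ verts
  asymm : ∀ u v, Adj u v → ¬ Adj v u

/-- There are finitely many oriented graphs with vertices in a finite set, so that the
cardinalities `Set.ncard` below are genuine. -/
instance OrientedGraph.instFinite {V : Type*} [Finite V] : Finite (OrientedGraph V) := by
  refine Finite.of_injective (β := Finset V × (V → V → Prop)) (fun G => (G.verts, G.Adj)) ?_
  intro G G' h
  exact OrientedGraph.ext (congrArg Prod.fst h) (congrArg Prod.snd h)

/-- The underlying undirected graph of an oriented graph. -/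
def OrientedGraph.underlying {V : Type*} (D : OrientedGraph V) : FinGraph V where
  verts := D.verts
  Adj u v := D.Adj u v ∨ D.Adj v u
  mem_verts := by
    rintro u v (h | h)
    · exact D.mem_verts u v h
    · exact (D.mem_verts v u h).symm
  symm := fun _ _ h => h.symm
  loopless := by
    rintro v (h | h) <;> exact D.asymm v v h h

/-- The oriented graph with no vertices. -/
def OrientedGraph.empty (V : Type*) : OrientedGraph V where
  verts := ∅
  Adj _ _ := False
  mem_verts := fun _ _ h => h.elim
  asymm := fun _ _ h => h.elim

/-- `D.delete X` is the oriented graph `D[V(D) \ X]`. -/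
def OrientedGraph.delete {V : Type*} [DecidableEq V] (D : OrientedGraph V) (X : Finset V) :
    OrientedGraph V where
  verts := D.verts \ X
  Adj u v := D.Adj u v ∧ u ∉ X ∧ v ∉ X
  mem_verts := fun u v h =>
    ⟨Finset.mem_sdiff.mpr ⟨(D.mem_verts u v h.1).1, h.2.1⟩,
      Finset.mem_sdiff.mpr ⟨(D.mem_verts u v h.1).2, h.2.2⟩⟩
  asymm := fun u v h h' => D.asymm u v h.1 h'.1

/-- `D.power r` is the digraph with an edge `(u, v)` precisely when `D` contains a directed path
with `r` edges (hence `r + 1` distinct vertices) starting at `u` and ending at `v`. -/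
def OrientedGraph.power {V : Type*} (D : OrientedGraph V) (r : ℕ) : Digraph V where
  Adj u v := ∃ f : Fin (r + 1) → V, Function.Injective f ∧ f 0 = u ∧ f (Fin.last r) = v ∧
    ∀ i : Fin r, D.Adj (f i.castSucc) (f i.succ)

/-- `D` contains no (not necessarily induced) directed cycle of length `ℓ + 2`. The addition
`i + 1` is cyclic in `Fin (ℓ + 2)`. -/
def OrientedGraph.CycleFree {V : Type*} (D : OrientedGraph V) (ℓ : ℕ) : Prop :=
  ¬ ∃ c : Fin (ℓ + 2) → V, Function.Injective c ∧ ∀ i : Fin (ℓ + 2), D.Adj (c i) (c (i + 1))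

open Classical in
/-- The number of edges of the digraph `D` between the (disjoint) sets `S` and `T`, in either
direction. -/
noncomputable def edgesBetween {V : Type*} (D : Digraph V) (S T : Finset V) : ℕ :=
  ((S ×ˢ T).filter (fun e => D.Adj e.1 e.2)).card +
    ((S ×ˢ T).filter (fun e => D.Adj e.2 e.1)).card

/-- The quantity `α = 2⁶ (log n) / p`, which serves as a number of vertices, rounded up to an
even integer. -/
noncomputable def alpha (n : ℕ) (p : ℝ) : ℕ := 2 * ⌈2 ^ 5 * Real.log n / p⌉₊

/-- `r`-local density of an oriented graph on a subset of `[n]` (used for `1 ≤ r ≤ ℓ`). -/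
def LocallyDense {n : ℕ} (ℓ : ℕ) (p : ℝ) (r : ℕ) (D : OrientedGraph (Fin n)) : Prop :=
  ∀ A' B X : Finset (Fin n), A' ⊆ D.verts → B ⊆ D.verts → X ⊆ D.verts →
    Disjoint A' B → Disjoint A' X → Disjoint B X →
    A'.card = alpha n p → r * alpha n p ≤ B.card → B.card ≤ ℓ * alpha n p →
    X.card ≤ (ℓ + 1 - r) * alpha n p →
    (1 / 2 : ℝ) * p ^ (((ℓ : ℝ) - r + 1) / ℓ) * A'.card * B.card ≤
      (edgesBetween ((D.delete X).power r) A' B : ℝ)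

/-- `D` is an orientation of `G` that extends the oriented graph `H`. -/
def IsExtension {V : Type*} (G : FinGraph V) (H D : OrientedGraph V) : Prop :=
  D.underlying = G ∧ ∀ u v, H.Adj u v → D.Adj u v

/-- `𝒟_r(G, H)`: the set of all `1`-locally dense, `r`-locally dense orientations of `G` that
extend `H` and contain no directed cycle of length `ℓ + 2`. -/
def denseExtensions {n : ℕ} (ℓ : ℕ) (p : ℝ) (r : ℕ) (G : FinGraph (Fin n))
    (H : OrientedGraph (Fin n)) : Set (OrientedGraph (Fin n)) :=
  {D | IsExtension G H D ∧ LocallyDense ℓ p 1 D ∧ D.CycleFree ℓ ∧ LocallyDense ℓ p r D}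

/-- `(A, H, B, X)` is an `r`-frame (used for `1 ≤ r ≤ ℓ`); `W` is the vertex set of `H`. -/
def IsFrame {n : ℕ} (ℓ : ℕ) (p : ℝ) (r : ℕ) (A W B X : Finset (Fin n)) : Prop :=
  Disjoint A W ∧ B ⊆ W ∧ X ⊆ W ∧ Disjoint B X ∧ 2 * A.card = alpha n p ∧
    r * alpha n p ≤ B.card ∧ B.card ≤ ℓ * alpha n p ∧ X.card ≤ (ℓ + 1 - r) * alpha n p

/-- `𝒮_r(G, H, B, X)`: the set of all orientations of `G` that are `(r, B, X)`-sparse extensions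
of `H`, where `A = V(G) \ V(H)`. -/
def sparseExtensions {n : ℕ} (ℓ : ℕ) (p : ℝ) (r : ℕ) (G : FinGraph (Fin n))
    (H : OrientedGraph (Fin n)) (B X : Finset (Fin n)) : Set (OrientedGraph (Fin n)) :=
  {D | IsExtension G H D ∧ ∀ a ∈ G.verts \ H.verts,
    (edgesBetween ((D.delete X).power r) {a} B : ℝ) ≤
      p ^ (((ℓ : ℝ) - r + 1) / ℓ) * B.card}

/-- The unordered pairs of distinct elements of `A ∪ W` that are not contained in `W`. -/
def newPairs {V : Type*} [DecidableEq V] (A W : Finset V) : Finset (Sym2 V) :=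
  ((A ∪ W).sym2.filter (fun e => ¬ e.IsDiag)) \ W.sym2

/-- The graph on `A ∪ V(H)` obtained from `H` by adding those pairs in `newPairs A V(H)` that
belong to `S` as edges. -/
def FinGraph.extend {V : Type*} [DecidableEq V] (H : FinGraph V) (A : Finset V)
    (S : Finset (Sym2 V)) : FinGraph V where
  verts := A ∪ H.verts
  Adj u v := H.Adj u v ∨ (s(u, v) ∈ S ∧ s(u, v) ∈ newPairs A H.verts)
  mem_verts := by
    rintro u v (h | h)
    · exact ⟨Finset.mem_union_right _ (H.mem_verts u v h).1,
        Finset.mem_union_right _ (H.mem_verts u v h).2⟩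
    · have h2 := (Finset.mem_filter.mp (Finset.mem_sdiff.mp h.2).1).1
      exact Finset.mk_mem_sym2_iff.mp h2
  symm := by
    rintro u v (h | h)
    · exact Or.inl (H.symm u v h)
    · rw [Sym2.eq_swap]
      exact Or.inr (by simpa only [Sym2.eq_swap] using h)
  loopless := by
    rintro v (h | h)
    · exact H.loopless v h
    · have h2 := (Finset.mem_filter.mp (Finset.mem_sdiff.mp h.2).1).2
      exact h2 (by simp)

/-- The expectation of `f(G)` for the random graph `G = G(A, H, p)`: the graph on `A ∪ V(H)` that
induces `H` on `V(H)` and contains each pair in `newPairs A V(H)` independently with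
probability `p`, so that the set of added edges is `S` with probability
`p ^ |S| * (1 - p) ^ (|newPairs A V(H)| - |S|)`. -/
noncomputable def expectExt {V : Type*} [DecidableEq V] (A : Finset V) (H : FinGraph V) (p : ℝ)
    (f : FinGraph V → ℝ) : ℝ :=
  ∑ S ∈ (newPairs A H.verts).powerset,
    p ^ S.card * (1 - p) ^ ((newPairs A H.verts).card - S.card) * f (H.extend A S)

/-! Every new pair is listed at exactly one vertex a of A, so an extension of H is encoded by one
row of signs for each a: absent, outgoing or incoming, with weights 1 - p, p, p. The expectation is
a sum of such weights over the admissible tuples of rows. Relaxing admissibility to a condition `Q`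
on each row separately turns the bound into a product over A of row weights (`expectExt_ncard_le`).

A row is bounded by branching on a vertex v and a sign ε (`patternSum_branch`). If v does not
receive ε, the other two weights sum to 1 and v is free. If it does, a factor p is paid and the
choice restricts the rest of the row. Local density supplies a v with a strong restriction as long
as many vertices remain; each leftover vertex contributes at most 1 + p.

For (i), an arc between a and x extends the paths with r - 1 edges between x and B. Sparseness
therefore bounds by M the total size of the sets covered by the neighbours of a, while density in
the power r - 1 yields a v covering at least q new elements (`exists_large_neighborhood`). Here M/q
= 8p^(-1/ℓ) limits the number of costly choices (`patternSum_coverLE_le`).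

For (ii), a path with ℓ edges from an outneighbour of a to an inneighbour of a closes up to a
forbidden cycle. By ℓ-density some v has large out- or indegree in the ℓ-th power
(`exists_large_degree`), so one costly choice frees a fraction δ = p^(1/ℓ)/5 of the remaining
vertices. This leads to the exponent (log n)/δ (`patternSum_separated_le`).

Density is assumed of the extension D, but it is applied only with A deleted, where D agrees with H.
Hence one member of the family gives the density needed for all rows of all members; if there is no
member, the expectation is 0. -/

/-- The probability weight of the state of a pair: `0` for a non-edge, `±1` for an edge with a
prescribed orientation. -/
noncomputable def edgeWeight (p : ℝ) (s : SignType) : ℝ := if s = 0 then 1 - p else p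

lemma edgeWeight_nonneg {p : ℝ} (h0 : 0 ≤ p) (h1 : p ≤ 1) (s : SignType) : 0 ≤ edgeWeight p s := by
  unfold edgeWeight
  split_ifs <;> linarith

lemma sum_edgeWeight (p : ℝ) : ∑ s, edgeWeight p s = 1 + p := by
  have : (Finset.univ : Finset SignType) = {0, -1, 1} := rfl
  rw [this]
  simp [edgeWeight]

/-! ### Weighted sums over sign patterns, bounded by branching. -/

section PatternSum

variable {V : Type*} [DecidableEq V]

/-- `Q` is preserved when signs are erased. -/
def IsLowerPattern (Q : (V → SignType) → Prop) : Prop :=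
  ∀ ρ x, Q ρ → Q (Function.update ρ x 0)

lemma IsLowerPattern.update {Q : (V → SignType) → Prop} (hQ : IsLowerPattern Q) (v : V)
    (s : SignType) : IsLowerPattern fun ρ => Q (Function.update ρ v s) := by
  intro ρ x h
  by_cases hx : x = v
  · subst hx
    simpa using h
  · show Q _
    rw [Function.update_comm hx]
    exact hQ _ _ h

/-- No positive `x` and negative `y` are related by `R`. -/
def Separated (R : V → V → Prop) (ρ : V → SignType) : Prop :=
  ∀ x y, ρ x = 1 → ρ y = -1 → ¬ R x y

lemma isLowerPattern_separated (R : V → V → Prop) : IsLowerPattern (Separated R) := by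
  intro ρ z h x y hx hy
  refine h x y ?_ ?_
  · by_cases hz : x = z
    · subst hz; simp at hx
    · rwa [Function.update_of_ne hz] at hx
  · by_cases hz : y = z
    · subst hz; simp at hy
    · rwa [Function.update_of_ne hz] at hy

variable [Fintype V]

/-- The sign patterns supported on `C`. -/
def signPatterns (C : Finset V) : Finset (V → SignType) :=
  Finset.univ.filter fun ρ => ∀ x, x ∉ C → ρ x = 0

open Classical in
/-- The total weight of the sign patterns supported on `C` that satisfy `Q`. -/
noncomputable def patternSum (p : ℝ) (C : Finset V) (Q : (V → SignType) → Prop) : ℝ :=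
  ∑ ρ ∈ signPatterns C, if Q ρ then ∏ x ∈ C, edgeWeight p (ρ x) else 0

lemma mem_signPatterns {C : Finset V} {ρ : V → SignType} :
    ρ ∈ signPatterns C ↔ ∀ x, x ∉ C → ρ x = 0 := by
  simp [signPatterns]

lemma patternSum_nonneg {p : ℝ} (h0 : 0 ≤ p) (h1 : p ≤ 1) (C : Finset V)
    (Q : (V → SignType) → Prop) : 0 ≤ patternSum p C Q := by
  refine Finset.sum_nonneg fun ρ _ => ?_
  split_ifs
  · exact Finset.prod_nonneg fun x _ => edgeWeight_nonneg h0 h1 _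
  · exact le_rfl

lemma patternSum_mono {p : ℝ} (h0 : 0 ≤ p) (h1 : p ≤ 1) {C : Finset V}
    {Q Q' : (V → SignType) → Prop} (h : ∀ ρ ∈ signPatterns C, Q ρ → Q' ρ) :
    patternSum p C Q ≤ patternSum p C Q' := by
  refine Finset.sum_le_sum fun ρ hρ => ?_
  have h2 := Finset.prod_nonneg fun x (_ : x ∈ C) => edgeWeight_nonneg h0 h1 (ρ x)
  by_cases hq : Q ρ
  · rw [if_pos hq, if_pos (h ρ hρ hq)]
  · rw [if_neg hq]
    split_ifs
    · exact h2
    · exact le_rfl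

lemma patternSum_eq_zero {p : ℝ} {C : Finset V} {Q : (V → SignType) → Prop}
    (h : ∀ ρ ∈ signPatterns C, ¬ Q ρ) : patternSum p C Q = 0 :=
  Finset.sum_eq_zero fun ρ hρ => if_neg (h ρ hρ)

lemma patternSum_insert (p : ℝ) {C : Finset V} {v : V} (hv : v ∉ C)
    (Q : (V → SignType) → Prop) :
    patternSum p (insert v C) Q =
      ∑ s, edgeWeight p s * patternSum p C fun ρ => Q (Function.update ρ v s) := by
  unfold patternSum
  simp_rw [Finset.mul_sum]
  rw [← Finset.sum_product']
  symm
  refine Finset.sum_nbij' (fun q => Function.update q.2 v q.1)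
    (fun ρ => (ρ v, Function.update ρ v 0)) ?_ ?_ ?_ ?_ ?_
  · rintro ⟨s, ρ⟩ h
    simp only [Finset.mem_product, Finset.mem_univ, true_and, mem_signPatterns] at h ⊢
    intro x hx
    rw [Finset.mem_insert, not_or] at hx
    rw [Function.update_of_ne hx.1]
    exact h x hx.2
  · intro ρ h
    simp only [Finset.mem_product, Finset.mem_univ, true_and, mem_signPatterns] at h ⊢
    intro x hx
    by_cases hxv : x = v
    · subst hxv; simp
    · rw [Function.update_of_ne hxv]
      exact h x (by simp [hxv, hx])
  · rintro ⟨s, ρ⟩ h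
    simp only [Finset.mem_product, Finset.mem_univ, true_and, mem_signPatterns] at h ⊢
    simp [← h v hv]
  · intro ρ _
    simp
  · rintro ⟨s, ρ⟩ _
    have h3 : ∏ x ∈ C, edgeWeight p (Function.update ρ v s x) = ∏ x ∈ C, edgeWeight p (ρ x) := by
      refine Finset.prod_congr rfl fun x hx => ?_
      rw [Function.update_of_ne]
      rintro rfl
      exact hv hx
    simp only [Finset.prod_insert hv, Function.update_self, h3, mul_ite, mul_zero]

/-- The fallback where branching stops: both orientations have weight p, so a vertex contributes (1
- p) + 2p. -/
lemma patternSum_le_pow {p : ℝ} (h0 : 0 ≤ p) (h1 : p ≤ 1) (C : Finset V)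
    (Q : (V → SignType) → Prop) : patternSum p C Q ≤ (1 + p) ^ C.card := by
  induction C using Finset.induction_on generalizing Q with
  | empty =>
    have : signPatterns (∅ : Finset V) = {fun _ => 0} := by
      ext ρ
      simp [mem_signPatterns, funext_iff]
    unfold patternSum
    rw [this, Finset.sum_singleton]
    split_ifs <;> simp
  | insert v C hv ih =>
    rw [patternSum_insert p hv, Finset.card_insert_of_notMem hv, pow_succ']
    refine (Finset.sum_le_sum fun s _ =>
      mul_le_mul_of_nonneg_left (ih _) (edgeWeight_nonneg h0 h1 s)).trans ?_
    rw [← Finset.sum_mul, sum_edgeWeight]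

/-- A pattern supported on C vanishes at v, so erasing the prescribed sign of v gives back the
pattern itself. -/
lemma patternSum_update_le {p : ℝ} (h0 : 0 ≤ p) (h1 : p ≤ 1) {C : Finset V} {v : V} (hv : v ∉ C)
    {Q : (V → SignType) → Prop} (hQ : IsLowerPattern Q) (s : SignType) :
    (patternSum p C fun ρ => Q (Function.update ρ v s)) ≤ patternSum p C Q := by
  refine patternSum_mono h0 h1 fun ρ hρ h => ?_
  have h2 := hQ _ v h
  rwa [Function.update_idem, Function.update_eq_self_iff.mpr (mem_signPatterns.mp hρ v hv).symm]
    at h2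

/-- Either the sign of `v` differs from `ε`, and `v` costs nothing, or it is `ε`. -/
lemma patternSum_branch {p : ℝ} (h0 : 0 ≤ p) (h1 : p ≤ 1) {C : Finset V} {v : V} (hv : v ∉ C)
    {Q : (V → SignType) → Prop} (hQ : IsLowerPattern Q) {ε : SignType} (hε : ε ≠ 0) :
    patternSum p (insert v C) Q ≤
      patternSum p C Q + p * patternSum p C fun ρ => Q (Function.update ρ v ε) := by
  have hu : (Finset.univ : Finset SignType) = {0, -1, 1} := rfl
  rw [patternSum_insert p hv, hu]
  -- Each of the three signs of v leaves at most the unrestricted sum; those of 0 and -ε, with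
  -- weights 1 - p and p, add up to one copy of it.
  have hz := patternSum_update_le h0 h1 hv hQ 0
  have hn := patternSum_update_le h0 h1 hv hQ (-1)
  have hp := patternSum_update_le h0 h1 hv hQ 1
  have h1' : 0 ≤ 1 - p := by linarith
  have a := mul_le_mul_of_nonneg_left hz h1'
  have b := mul_le_mul_of_nonneg_left hn h0
  have c := mul_le_mul_of_nonneg_left hp h0
  cases ε with
  | zero => exact absurd rfl hε
  | neg => simp [edgeWeight] at *; linarith
  | pos => simp [edgeWeight] at *; linarith

lemma patternSum_insert_le {p : ℝ} (h0 : 0 ≤ p) (h1 : p ≤ 1) {C : Finset V} {v : V} (hv : v ∉ C)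
    {Q : (V → SignType) → Prop} (hQ : IsLowerPattern Q) {ε : SignType} (hε : ε ≠ 0)
    (h : ∀ ρ, Q ρ → ρ v ≠ ε) : patternSum p (insert v C) Q ≤ patternSum p C Q := by
  refine (patternSum_branch h0 h1 hv hQ hε).trans ?_
  rw [patternSum_eq_zero (Q := fun ρ => Q (Function.update ρ v ε))]
  · simp
  · intro ρ _ hq
    exact h _ hq (by simp)

/-- Vertices whose sign cannot be `ε` cost nothing. -/
lemma patternSum_le_sdiff {p : ℝ} (h0 : 0 ≤ p) (h1 : p ≤ 1) (C T : Finset V)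
    {Q : (V → SignType) → Prop} (hQ : IsLowerPattern Q) {ε : SignType} (hε : ε ≠ 0)
    (h : ∀ v ∈ T, ∀ ρ, Q ρ → ρ v ≠ ε) : patternSum p C Q ≤ patternSum p (C \ T) Q := by
  induction T using Finset.induction_on with
  | empty => simp
  | insert v T hv ih =>
    refine (ih fun w hw => h w (Finset.mem_insert_of_mem hw)).trans ?_
    rw [Finset.sdiff_insert]
    by_cases hvC : v ∈ C \ T
    · conv_lhs => rw [← Finset.insert_erase hvC]
      exact patternSum_insert_le h0 h1 (Finset.notMem_erase _ _) hQ hε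
        (h v (Finset.mem_insert_self _ _))
    · rw [Finset.erase_eq_of_notMem hvC]

/-- The recursion behind the separated case. As (1 - δ)^s ≤ exp(-sδ) = 1/N ≤ 1/m, the second summand
is at most m^s/m, and this is the loss in (m - 1)^s ≤ m^s(1 - 1/m). -/
lemma rpow_branch {p δ s N m k : ℝ} (h1 : p ≤ 1) (hs : 1 ≤ s)
    (hN : 1 ≤ N) (hsN : s * δ = Real.log N) (hm : 1 ≤ m) (hmN : m ≤ N) (hk0 : 0 ≤ k)
    (hk : k ≤ (1 - δ) * m) : (m - 1) ^ s + p * k ^ s ≤ m ^ s := by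
  have hm0 : 0 < m := by linarith
  have hN0 : 0 < N := by linarith
  have hδ1 : 0 ≤ 1 - δ := by
    by_contra hc
    push Not at hc
    nlinarith
  have hms : 0 ≤ m ^ s := by positivity
  have e1 : k ^ s ≤ m ^ s * N⁻¹ := by
    calc k ^ s ≤ ((1 - δ) * m) ^ s := Real.rpow_le_rpow hk0 hk (by linarith)
      _ = (1 - δ) ^ s * m ^ s := Real.mul_rpow hδ1 hm0.le
      _ ≤ (Real.exp (-δ)) ^ s * m ^ s := by
        gcongr
        have := Real.add_one_le_exp (-δ)
        linarith
      _ = m ^ s * N⁻¹ := by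
        rw [← Real.exp_mul, show -δ * s = - Real.log N by rw [← hsN]; ring, Real.exp_neg,
          Real.exp_log hN0, mul_comm]
  have e2 : (m - 1) ^ s ≤ m ^ s * (1 - m⁻¹) := by
    have hb0 : 0 ≤ 1 - m⁻¹ := by
      have := inv_le_one_of_one_le₀ hm
      linarith
    have : m - 1 = m * (1 - m⁻¹) := by field_simp
    rw [this, Real.mul_rpow hm0.le hb0]
    gcongr
    have := Real.rpow_le_rpow_of_exponent_ge' hb0 (sub_le_self 1 (by positivity)) zero_le_one hs
    simpa using this
  have e3 : N⁻¹ ≤ m⁻¹ := inv_anti₀ hm0 hmN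
  have e4 : p * k ^ s ≤ m ^ s * m⁻¹ := by
    have := Real.rpow_nonneg hk0 s
    calc p * k ^ s ≤ 1 * k ^ s := by gcongr
      _ ≤ m ^ s * N⁻¹ := by linarith
      _ ≤ _ := by gcongr
  linarith [mul_sub (m ^ s) 1 m⁻¹]

open Classical in
/-- The weight of the separated patterns when every large subset of `C₀` contains a vertex of
large out- or indegree. -/
lemma patternSum_separated_le {p : ℝ} (h0 : 0 ≤ p) (h1 : p ≤ 1) (R : V → V → Prop)
    (C₀ : Finset V) (K : ℕ) {δ s N : ℝ} (hs : 1 ≤ s)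
    (hN : (C₀.card : ℝ) + 1 ≤ N) (hsN : s * δ = Real.log N)
    (hR : ∀ C' ⊆ C₀, K ≤ C'.card → ∃ v ∈ C',
      δ * (C'.card + 1) ≤ (C'.filter fun y => R v y ∧ y ≠ v).card ∨
      δ * (C'.card + 1) ≤ (C'.filter fun y => R y v ∧ y ≠ v).card) (C : Finset V) :
    patternSum p C (Separated R) ≤
      (1 + p) ^ (K + (C \ C₀).card) * (((C ∩ C₀).card : ℝ) + 1) ^ s := by
  induction hm : (C ∩ C₀).card using Nat.strong_induction_on generalizing C with
  | _ m ih =>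
  subst hm
  have hbase : 0 ≤ (1 + p) ^ (K + (C \ C₀).card) := by positivity
  by_cases hK : K ≤ (C ∩ C₀).card
  · obtain ⟨v, hv, hd⟩ := hR _ Finset.inter_subset_right hK
    have hvC := (Finset.mem_inter.mp hv).1
    have hv0 := (Finset.mem_inter.mp hv).2
    have key : ∀ (ε : SignType) (T : Finset V), ε ≠ 0 → T ⊆ C ∩ C₀ → v ∉ T →
        δ * ((C ∩ C₀).card + 1) ≤ T.card →
        (∀ y ∈ T, ∀ ρ, Separated R (Function.update ρ v ε) → ρ y ≠ -ε) →
        patternSum p C (Separated R) ≤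
          (1 + p) ^ (K + (C \ C₀).card) * (((C ∩ C₀).card : ℝ) + 1) ^ s := by
      intro ε T hε hT hvT hTd hsep
      have hb := patternSum_branch h0 h1 (Finset.notMem_erase v C)
        (isLowerPattern_separated R) hε
      rw [Finset.insert_erase hvC] at hb
      -- With the sign ε at v, no vertex of T can have the sign -ε, so all of T is free; the
      -- constraint from v is then dropped.
      have hb2 := patternSum_le_sdiff h0 h1 (C.erase v) T
        ((isLowerPattern_separated R).update v ε) (by revert hε; clear * -; cases ε <;> decide) hsep
      have hb3 := patternSum_update_le h0 h1 (C := C.erase v \ T) (v := v) (by simp)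
        (isLowerPattern_separated R) ε
      have c1 : (C.erase v ∩ C₀).card + 1 = (C ∩ C₀).card := by
        rw [Finset.erase_inter, Finset.card_erase_add_one hv]
      have c2 : ((C.erase v \ T) ∩ C₀).card + T.card + 1 = (C ∩ C₀).card := by
        have : (C.erase v \ T) ∩ C₀ = ((C ∩ C₀).erase v) \ T := by
          ext x; simp; tauto
        rw [this, ← c1, Finset.erase_inter, Finset.card_sdiff_add_card_eq_card]
        exact Finset.subset_erase.mpr ⟨hT, hvT⟩
      have d1 : C.erase v \ C₀ = C \ C₀ := by
        ext x; simp only [Finset.mem_sdiff, Finset.mem_erase]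
        constructor
        · tauto
        · rintro ⟨a, b⟩
          exact ⟨⟨by rintro rfl; exact b hv0, a⟩, b⟩
      have d2 : (C.erase v \ T) \ C₀ = C \ C₀ := by
        rw [← d1]
        ext x; simp only [Finset.mem_sdiff]
        constructor
        · tauto
        · rintro ⟨a, b⟩
          exact ⟨⟨a, fun h => b (Finset.mem_inter.mp (hT h)).2⟩, b⟩
      have i1 := ih _ (by omega) (C.erase v) rfl
      have i2 := ih _ (by omega) (C.erase v \ T) rfl
      rw [d1] at i1
      rw [d2] at i2
      have c1' : ((C.erase v ∩ C₀).card : ℝ) + 1 = (C ∩ C₀).card := by exact_mod_cast c1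
      have c2' : (((C.erase v \ T) ∩ C₀).card : ℝ) + T.card + 1 = (C ∩ C₀).card := by
        exact_mod_cast c2
      have hcard : ((C ∩ C₀).card : ℝ) ≤ C₀.card := by
        exact_mod_cast Finset.card_le_card Finset.inter_subset_right
      have hC00 : (0 : ℝ) ≤ (C ∩ C₀).card := by positivity
      have hr := rpow_branch (k := (((C.erase v \ T) ∩ C₀).card : ℝ) + 1)
        (m := ((C ∩ C₀).card : ℝ) + 1) h1 hs (by linarith)
        hsN (by linarith) (by linarith) (by positivity) (by linarith)
      rw [add_sub_cancel_right] at hr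
      rw [c1'] at i1
      calc patternSum p C (Separated R)
          ≤ _ + p * _ := hb
        _ ≤ (1 + p) ^ (K + (C \ C₀).card) * ((C ∩ C₀).card : ℝ) ^ s +
            p * ((1 + p) ^ (K + (C \ C₀).card) *
              ((((C.erase v \ T) ∩ C₀).card : ℝ) + 1) ^ s) :=
          add_le_add i1 (mul_le_mul_of_nonneg_left (hb2.trans (hb3.trans i2)) h0)
        _ = (1 + p) ^ (K + (C \ C₀).card) * (((C ∩ C₀).card : ℝ) ^ s +
            p * ((((C.erase v \ T) ∩ C₀).card : ℝ) + 1) ^ s) := by ring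
        _ ≤ _ := mul_le_mul_of_nonneg_left hr hbase
    rcases hd with hd | hd
    · refine key 1 _ (by decide) (Finset.filter_subset _ _) (by simp) hd ?_
      intro y hy ρ h hy'
      simp only [Finset.mem_filter] at hy
      exact h v y (by simp) (by rw [Function.update_of_ne hy.2.2, hy']) hy.2.1
    · refine key (-1) _ (by decide) (Finset.filter_subset _ _) (by simp) hd ?_
      intro y hy ρ h hy'
      simp only [Finset.mem_filter] at hy
      exact h y v (by rw [Function.update_of_ne hy.2.2, hy', neg_neg]) (by simp) hy.2.1
  -- Fewer than K vertices of `C₀` remain, and all of C is estimated trivially.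
  · refine (patternSum_le_pow h0 h1 C _).trans ?_
    have e1 : (1 + p) ^ C.card ≤ (1 + p) ^ (K + (C \ C₀).card) := by
      refine pow_le_pow_right₀ (by linarith) ?_
      have := Finset.card_inter_add_card_sdiff C C₀
      omega
    have e2 : (1 : ℝ) ≤ (((C ∩ C₀).card : ℝ) + 1) ^ s :=
      Real.one_le_rpow (by linarith [Nat.cast_nonneg (α := ℝ) (C ∩ C₀).card]) (by linarith)
    calc (1 + p) ^ C.card ≤ (1 + p) ^ (K + (C \ C₀).card) * 1 := by rw [mul_one]; exact e1
      _ ≤ _ := mul_le_mul_of_nonneg_left e2 hbase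

/-! ### Branching with a covering budget. -/

/-- The sets covered by positive vertices (through `f`) and by negative vertices (through `g`),
together with the initial sets `U` and `U'`, have total size at most `M`. -/
def CoverLE (f g : V → Finset V) (M : ℝ) (U U' : Finset V) (ρ : V → SignType) : Prop :=
  ((U ∪ (Finset.univ.filter fun x => ρ x = 1).biUnion f).card : ℝ) +
    (U' ∪ (Finset.univ.filter fun x => ρ x = -1).biUnion g).card ≤ M

lemma filter_update_zero_subset (ρ : V → SignType) (x : V) {ε : SignType} (hε : ε ≠ 0) :
    (Finset.univ.filter fun y => Function.update ρ x 0 y = ε) ⊆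
      Finset.univ.filter fun y => ρ y = ε := by
  intro y
  simp only [Finset.mem_filter, Finset.mem_univ, true_and]
  by_cases hy : y = x
  · subst hy
    rw [Function.update_self]
    exact fun h => absurd h.symm hε
  · rw [Function.update_of_ne hy]
    exact id

lemma isLowerPattern_coverLE (f g : V → Finset V) (M : ℝ) (U U' : Finset V) :
    IsLowerPattern (CoverLE f g M U U') := by
  intro ρ x h
  refine le_trans (add_le_add ?_ ?_) h
  · exact_mod_cast Finset.card_le_card (Finset.union_subset_union_right
      (Finset.biUnion_subset_biUnion_of_subset_left _
        (filter_update_zero_subset ρ x (by decide))))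
  · exact_mod_cast Finset.card_le_card (Finset.union_subset_union_right
      (Finset.biUnion_subset_biUnion_of_subset_left _
        (filter_update_zero_subset ρ x (by decide))))

lemma filter_subset_update {ρ : V → SignType} {v : V} (h : ρ v = 0) {ε : SignType} (hε : ε ≠ 0)
    (s : SignType) : (Finset.univ.filter fun y => ρ y = ε) ⊆
      Finset.univ.filter fun y => Function.update ρ v s y = ε := by
  intro y
  simp only [Finset.mem_filter, Finset.mem_univ, true_and]
  by_cases hy : y = v
  · subst hy
    rw [h]
    exact fun h => absurd h.symm hε
  · rw [Function.update_of_ne hy]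
    exact id

/-- The accounting of a costly choice: the set covered by v moves into the initial set and uses up
budget. -/
lemma CoverLE.of_update_one {f g : V → Finset V} {M : ℝ} {U U' : Finset V} {ρ : V → SignType}
    {v : V} (hv : ρ v = 0) (h : CoverLE f g M U U' (Function.update ρ v 1)) :
    CoverLE f g M (U ∪ f v) U' ρ := by
  refine le_trans (add_le_add ?_ ?_) h
  · refine Nat.cast_le.mpr (Finset.card_le_card ?_)
    rw [Finset.union_assoc]
    refine Finset.union_subset_union_right (Finset.union_subset ?_ ?_)
    · exact Finset.subset_biUnion_of_mem f (by simp)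
    · exact Finset.biUnion_subset_biUnion_of_subset_left _
        (filter_subset_update hv (by decide) _)
  · exact_mod_cast Finset.card_le_card (Finset.union_subset_union_right
      (Finset.biUnion_subset_biUnion_of_subset_left _
        (filter_subset_update hv (by decide) _)))

lemma CoverLE.of_update_neg_one {f g : V → Finset V} {M : ℝ} {U U' : Finset V}
    {ρ : V → SignType} {v : V} (hv : ρ v = 0)
    (h : CoverLE f g M U U' (Function.update ρ v (-1))) :
    CoverLE f g M U (U' ∪ g v) ρ := by
  refine le_trans (add_le_add ?_ ?_) h
  · exact_mod_cast Finset.card_le_card (Finset.union_subset_union_right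
      (Finset.biUnion_subset_biUnion_of_subset_left _
        (filter_subset_update hv (by decide) _)))
  · refine Nat.cast_le.mpr (Finset.card_le_card ?_)
    rw [Finset.union_assoc]
    refine Finset.union_subset_union_right (Finset.union_subset ?_ ?_)
    · exact Finset.subset_biUnion_of_mem g (by simp)
    · exact Finset.biUnion_subset_biUnion_of_subset_left _
        (filter_subset_update hv (by decide) _)

/-- The weight of the patterns that cover little when every large subset of `C₀` contains a vertex
that covers at least `q` new elements. -/
lemma patternSum_coverLE_le {p : ℝ} (h0 : 0 ≤ p) (h1 : p ≤ 1) (f g : V → Finset V)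
    (C₀ : Finset V) (K : ℕ) {M q : ℝ} (hq : 0 < q)
    (hR : ∀ U U' : Finset V, (U.card : ℝ) + U'.card ≤ M → ∀ C' ⊆ C₀, K ≤ C'.card → ∃ v ∈ C',
      q ≤ (f v \ U).card ∨ q ≤ (g v \ U').card)
    (C U U' : Finset V) (hU : (U.card : ℝ) + U'.card ≤ M) :
    patternSum p C (CoverLE f g M U U') ≤ (1 + p) ^ (K + (C \ C₀).card) *
      (((C ∩ C₀).card : ℝ) + 1) ^ ((M - U.card - U'.card) / q + 1) := by
  induction hm : (C ∩ C₀).card generalizing C U U' with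
  | zero =>
    refine (patternSum_le_pow h0 h1 C _).trans ?_
    simp only [Nat.cast_zero, zero_add, Real.one_rpow, mul_one]
    refine pow_le_pow_right₀ (by linarith) ?_
    have := Finset.card_inter_add_card_sdiff C C₀
    omega
  | succ m ih =>
  have hbase : 0 ≤ (1 + p) ^ (K + (C \ C₀).card) := by positivity
  have hκ : 0 ≤ (M - U.card - U'.card) / q := div_nonneg (by linarith) hq.le
  by_cases hK : K ≤ (C ∩ C₀).card
  · obtain ⟨v, hv, hd⟩ := hR U U' hU _ Finset.inter_subset_right hK
    have hvC := (Finset.mem_inter.mp hv).1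
    have hv0 := (Finset.mem_inter.mp hv).2
    have hm0 : (0 : ℝ) ≤ m := Nat.cast_nonneg m
    have c1 : (C.erase v ∩ C₀).card = m := by
      rw [Finset.erase_inter, Finset.card_erase_of_mem hv, hm, Nat.add_sub_cancel]
    have d1 : C.erase v \ C₀ = C \ C₀ := by
      ext x; simp only [Finset.mem_sdiff, Finset.mem_erase]
      constructor
      · tauto
      · rintro ⟨a, b⟩
        exact ⟨⟨by rintro rfl; exact b hv0, a⟩, b⟩
    have key : ∀ (ε : SignType) (T T' : Finset V), ε ≠ 0 →
        (U.card : ℝ) + U'.card + q ≤ T.card + T'.card →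
        (∀ ρ, ρ v = 0 → CoverLE f g M U U' (Function.update ρ v ε) → CoverLE f g M T T' ρ) →
        patternSum p C (CoverLE f g M U U') ≤ (1 + p) ^ (K + (C \ C₀).card) *
          (((m + 1 : ℕ) : ℝ) + 1) ^ ((M - U.card - U'.card) / q + 1) := by
      intro ε T T' hε hT hcov
      have hb := patternSum_branch h0 h1 (Finset.notMem_erase v C)
        (isLowerPattern_coverLE f g M U U') hε
      rw [Finset.insert_erase hvC] at hb
      have hb2 : (patternSum p (C.erase v) fun ρ => CoverLE f g M U U' (Function.update ρ v ε)) ≤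
          patternSum p (C.erase v) (CoverLE f g M T T') :=
        patternSum_mono h0 h1 fun ρ hρ h =>
          hcov ρ (mem_signPatterns.mp hρ v (Finset.notMem_erase _ _)) h
      have i1 := ih (C.erase v) U U' hU c1
      rw [d1] at i1
      have i2 : patternSum p (C.erase v) (CoverLE f g M T T') ≤
          (1 + p) ^ (K + (C \ C₀).card) * ((m : ℝ) + 1) ^ ((M - U.card - U'.card) / q) := by
        by_cases hTM : (T.card : ℝ) + T'.card ≤ M
        · have := ih (C.erase v) T T' hTM c1
          rw [d1] at this
          refine this.trans (mul_le_mul_of_nonneg_left ?_ hbase)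
          -- The budget has shrunk by at least q, so the exponent drops by at least 1.
          refine Real.rpow_le_rpow_of_exponent_le (by linarith) ?_
          rw [div_add_one hq.ne']
          gcongr
          linarith
        -- The initial sets alone exceed the budget.
        · rw [patternSum_eq_zero]
          · positivity
          · intro ρ _ h
            refine hTM (le_trans (add_le_add ?_ ?_) h)
            · exact_mod_cast Finset.card_le_card Finset.subset_union_left
            · exact_mod_cast Finset.card_le_card Finset.subset_union_left
      have hr : ((m : ℝ) + 1) ^ ((M - U.card - U'.card) / q + 1) +
          p * ((m : ℝ) + 1) ^ ((M - U.card - U'.card) / q) ≤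
          (((m + 1 : ℕ) : ℝ) + 1) ^ ((M - U.card - U'.card) / q + 1) := by
        rw [Real.rpow_add_one (by positivity), Real.rpow_add_one (by positivity)]
        have e : ((m : ℝ) + 1) ^ ((M - U.card - U'.card) / q) ≤
            (((m + 1 : ℕ) : ℝ) + 1) ^ ((M - U.card - U'.card) / q) := by
          refine Real.rpow_le_rpow (by positivity) ?_ hκ
          push_cast; linarith
        calc _ = ((m : ℝ) + 1) ^ ((M - U.card - U'.card) / q) * (m + 1 + p) := by ring
          _ ≤ _ := by
            refine mul_le_mul e ?_ (by positivity) (by positivity)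
            push_cast; linarith
      calc _ ≤ _ + p * _ := hb
        _ ≤ (1 + p) ^ (K + (C \ C₀).card) *
              ((m : ℝ) + 1) ^ ((M - U.card - U'.card) / q + 1) + p *
            ((1 + p) ^ (K + (C \ C₀).card) * ((m : ℝ) + 1) ^ ((M - U.card - U'.card) / q)) :=
          add_le_add i1 (mul_le_mul_of_nonneg_left (hb2.trans i2) h0)
        _ = (1 + p) ^ (K + (C \ C₀).card) *
              (((m : ℝ) + 1) ^ ((M - U.card - U'.card) / q + 1) +
            p * ((m : ℝ) + 1) ^ ((M - U.card - U'.card) / q)) := by ring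
        _ ≤ _ := mul_le_mul_of_nonneg_left hr hbase
    have hun : ∀ S T : Finset V, ((S ∪ T).card : ℝ) = S.card + (T \ S).card := by
      intro S T
      rw [← Nat.cast_add, ← Finset.card_union_of_disjoint Finset.disjoint_sdiff,
        Finset.union_sdiff_self_eq_union]
    rcases hd with hd | hd
    · refine key 1 (U ∪ f v) U' (by decide) ?_ fun ρ h => CoverLE.of_update_one h
      rw [hun]; linarith
    · refine key (-1) U (U' ∪ g v) (by decide) ?_ fun ρ h => CoverLE.of_update_neg_one h
      rw [hun]; linarith
  · refine (patternSum_le_pow h0 h1 C _).trans ?_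
    have e1 : (1 + p) ^ C.card ≤ (1 + p) ^ (K + (C \ C₀).card) := by
      refine pow_le_pow_right₀ (by linarith) ?_
      have := Finset.card_inter_add_card_sdiff C C₀
      omega
    have e2 : (1 : ℝ) ≤ (((m + 1 : ℕ) : ℝ) + 1) ^ ((M - U.card - U'.card) / q + 1) :=
      Real.one_le_rpow (by push_cast; linarith [Nat.cast_nonneg (α := ℝ) m]) (by linarith)
    calc (1 + p) ^ C.card ≤ (1 + p) ^ (K + (C \ C₀).card) * 1 := by rw [mul_one]; exact e1
      _ ≤ _ := mul_le_mul_of_nonneg_left e2 hbase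

end PatternSum

/-! ### Encoding extensions by rows, and factorising the expectation. -/

section Rows

variable {V : Type*} [LinearOrder V]

/-- The second vertices of the new pairs that are listed at `a ∈ A`: every new pair is listed at
exactly one vertex of `A`. -/
def rowSupport (A W : Finset V) (a : V) : Finset V := W ∪ A.filter (a < ·)

open Classical in
/-- The orientations in `D` of the pairs listed at `a`. -/
noncomputable def rowPattern (A W : Finset V) (D : OrientedGraph V) (a x : V) : SignType :=
  if x ∈ rowSupport A W a then if D.Adj a x then 1 else if D.Adj x a then -1 else 0 else 0

lemma rowPattern_eq_one {A W : Finset V} {D : OrientedGraph V} {a x : V}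
    (hx : x ∈ rowSupport A W a) : rowPattern A W D a x = 1 ↔ D.Adj a x := by
  unfold rowPattern
  rw [if_pos hx]
  split_ifs with h1 h2 <;> simp [h1]

lemma rowPattern_eq_neg_one {A W : Finset V} {D : OrientedGraph V} {a x : V}
    (hx : x ∈ rowSupport A W a) : rowPattern A W D a x = -1 ↔ D.Adj x a := by
  unfold rowPattern
  rw [if_pos hx]
  split_ifs with h1 h2
  · simpa using D.asymm _ _ h1
  · simp [h2]
  · simp [h2]

lemma adj_of_rowPattern_eq_one {A W : Finset V} {D : OrientedGraph V} {a x : V}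
    (h : rowPattern A W D a x = 1) : D.Adj a x := by
  by_cases hx : x ∈ rowSupport A W a
  · exact (rowPattern_eq_one hx).mp h
  · simp [rowPattern, hx] at h

lemma adj_of_rowPattern_eq_neg_one {A W : Finset V} {D : OrientedGraph V} {a x : V}
    (h : rowPattern A W D a x = -1) : D.Adj x a := by
  by_cases hx : x ∈ rowSupport A W a
  · exact (rowPattern_eq_neg_one hx).mp h
  · simp [rowPattern, hx] at h

lemma rowPattern_eq_zero {A W : Finset V} {D : OrientedGraph V} {a x : V}
    (hx : x ∈ rowSupport A W a) : rowPattern A W D a x = 0 ↔ ¬ D.underlying.Adj a x := by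
  unfold rowPattern OrientedGraph.underlying
  rw [if_pos hx]
  split_ifs with h1 h2 <;> simp [*]

lemma rowPattern_mem [Fintype V] (A W : Finset V) (D : OrientedGraph V) (a : V) :
    rowPattern A W D a ∈ signPatterns (rowSupport A W a) :=
  mem_signPatterns.mpr fun _ hx => if_neg hx

lemma mem_newPairs {A W : Finset V} {u v : V} :
    s(u, v) ∈ newPairs A W ↔ (u ∈ A ∪ W ∧ v ∈ A ∪ W) ∧ u ≠ v ∧ ¬ (u ∈ W ∧ v ∈ W) := by
  simp only [newPairs, Finset.mem_sdiff, Finset.mem_filter, Finset.mk_mem_sym2_iff,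
    Sym2.mk_isDiag_iff]
  tauto

lemma mk_mem_newPairs {A W : Finset V} (h : Disjoint A W) {a x : V} (ha : a ∈ A)
    (hx : x ∈ rowSupport A W a) : s(a, x) ∈ newPairs A W := by
  have haW : a ∉ W := Finset.disjoint_left.mp h ha
  rw [mem_newPairs]
  simp only [rowSupport, Finset.mem_union, Finset.mem_filter] at hx ⊢
  refine ⟨⟨Or.inl ha, by tauto⟩, ?_, fun hW => haW hW.1⟩
  rintro rfl
  rcases hx with hx | hx
  · exact haW hx
  · exact lt_irrefl _ hx.2

lemma exists_row {A W : Finset V} {u v : V} (h : s(u, v) ∈ newPairs A W) :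
    (u ∈ A ∧ v ∈ rowSupport A W u) ∨ (v ∈ A ∧ u ∈ rowSupport A W v) := by
  rw [mem_newPairs] at h
  simp only [rowSupport, Finset.mem_union, Finset.mem_filter] at h ⊢
  have := lt_or_gt_of_ne h.2.1
  tauto

/-- Products over new pairs are products over the rows. -/
lemma prod_newPairs {A W : Finset V} (h : Disjoint A W) (g : Sym2 V → ℝ) :
    ∏ e ∈ newPairs A W, g e = ∏ a ∈ A, ∏ x ∈ rowSupport A W a, g s(a, x) := by
  rw [Finset.prod_sigma']
  symm
  refine Finset.prod_nbij (fun q => s(q.1, q.2)) ?_ ?_ ?_ fun _ _ => rfl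
  · rintro ⟨a, x⟩ hq
    rw [Finset.mem_sigma] at hq
    exact mk_mem_newPairs h hq.1 hq.2
  · rintro ⟨a, x⟩ hq ⟨a', x'⟩ hq' he
    simp only [Finset.coe_sigma, Set.mem_sigma_iff, Finset.mem_coe] at hq hq'
    simp only [Sym2.eq_iff] at he
    rcases he with ⟨rfl, rfl⟩ | ⟨rfl, rfl⟩
    · rfl
    · have h1 := hq.2
      have h2 := hq'.2
      have n1 := Finset.disjoint_left.mp h hq.1
      have n2 := Finset.disjoint_left.mp h hq'.1
      simp only [rowSupport, Finset.mem_union, Finset.mem_filter, n1, n2, false_or] at h1 h2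
      exact absurd h1.2 h2.2.asymm
  · intro e
    induction e using Sym2.ind with
    | _ u v =>
    intro he
    rcases exists_row he with hr | hr
    · exact ⟨⟨u, v⟩, by simpa using hr, rfl⟩
    · exact ⟨⟨v, u⟩, by simpa using hr, Sym2.eq_swap⟩

/-- No pair inside `H.verts` is new, and asymmetry excludes the reversal of an arc of H. -/
lemma IsExtension.adj_iff {H D : OrientedGraph V} {A : Finset V} {S : Finset (Sym2 V)}
    (h : IsExtension (H.underlying.extend A S) H D) {u v : V} (hu : u ∈ H.verts)
    (hv : v ∈ H.verts) : D.Adj u v ↔ H.Adj u v := by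
  refine ⟨fun hD => ?_, h.2 u v⟩
  have h1 : D.underlying.Adj u v := Or.inl hD
  rw [h.1] at h1
  rcases h1 with (h1 | h1) | h1
  · exact h1
  · exact absurd (h.2 _ _ h1) (D.asymm _ _ hD)
  · exact absurd ⟨hu, hv⟩ (mem_newPairs.mp h1.2).2.2

lemma IsExtension.verts_eq {H D : OrientedGraph V} {A : Finset V} {S : Finset (Sym2 V)}
    (h : IsExtension (H.underlying.extend A S) H D) : D.verts = A ∪ H.verts :=
  congrArg FinGraph.verts h.1

lemma IsExtension.mem_iff {H D : OrientedGraph V} {A : Finset V} {S : Finset (Sym2 V)}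
    (h : IsExtension (H.underlying.extend A S) H D) {u v : V}
    (he : s(u, v) ∈ newPairs A H.verts) : s(u, v) ∈ S ↔ D.underlying.Adj u v := by
  rw [h.1]
  refine ⟨fun hS => Or.inr ⟨hS, he⟩, ?_⟩
  rintro (h1 | h1)
  · exact absurd (H.underlying.mem_verts _ _ h1) (mem_newPairs.mp he).2.2
  · exact h1.1

/-- A new pair is outside S exactly when its row entry is 0, and the direction of an edge does not
affect its weight. -/
lemma IsExtension.weight_eq {p : ℝ} {H D : OrientedGraph V} {A : Finset V} {S : Finset (Sym2 V)}
    (hA : Disjoint A H.verts) (hS : S ⊆ newPairs A H.verts)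
    (h : IsExtension (H.underlying.extend A S) H D) :
    p ^ S.card * (1 - p) ^ ((newPairs A H.verts).card - S.card) =
      ∏ a ∈ A, ∏ x ∈ rowSupport A H.verts a, edgeWeight p (rowPattern A H.verts D a x) := by
  calc p ^ S.card * (1 - p) ^ ((newPairs A H.verts).card - S.card)
      = ∏ e ∈ newPairs A H.verts, if e ∈ S then p else 1 - p := by
        rw [Finset.prod_ite, Finset.prod_const, Finset.prod_const, Finset.filter_mem_eq_inter,
          Finset.inter_eq_right.mpr hS, Finset.filter_notMem_eq_sdiff,
          Finset.card_sdiff_of_subset hS]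
    _ = ∏ a ∈ A, ∏ x ∈ rowSupport A H.verts a, if s(a, x) ∈ S then p else 1 - p :=
        prod_newPairs hA _
    _ = _ := by
        refine Finset.prod_congr rfl fun a ha => Finset.prod_congr rfl fun x hx => ?_
        have e1 := h.mem_iff (mk_mem_newPairs hA ha hx)
        have e2 := rowPattern_eq_zero (D := D) hx
        unfold edgeWeight
        by_cases hs : s(a, x) ∈ S
        · rw [if_pos hs, if_neg fun hz => e2.mp hz (e1.mp hs)]
        · rw [if_neg hs, if_pos (e2.mpr fun hz => hs (e1.mpr hz))]

/-- An extension is determined by its rows. -/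
lemma IsExtension.ext_rows {H D D' : OrientedGraph V} {A : Finset V} {S S' : Finset (Sym2 V)}
    (h : IsExtension (H.underlying.extend A S) H D)
    (h' : IsExtension (H.underlying.extend A S') H D')
    (hrow : ∀ a ∈ A, rowPattern A H.verts D a = rowPattern A H.verts D' a) : D = D' := by
  have hverts : D.verts = D'.verts := h.verts_eq.trans h'.verts_eq.symm
  have key : ∀ u v, u ∈ D.verts → v ∈ D.verts → (D.Adj u v ↔ D'.Adj u v) := by
    intro u v hu hv
    by_cases huv : u = v
    · subst huv
      exact iff_of_false (fun h => D.asymm _ _ h h) (fun h => D'.asymm _ _ h h)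
    by_cases hW : u ∈ H.verts ∧ v ∈ H.verts
    · rw [h.adj_iff hW.1 hW.2, h'.adj_iff hW.1 hW.2]
    · rw [h.verts_eq] at hu hv
      rcases exists_row (mem_newPairs.mpr ⟨⟨hu, hv⟩, huv, hW⟩) with hr | hr
      · rw [← rowPattern_eq_one hr.2, ← rowPattern_eq_one hr.2, hrow u hr.1]
      · rw [← rowPattern_eq_neg_one hr.2, ← rowPattern_eq_neg_one hr.2, hrow v hr.1]
  refine OrientedGraph.ext hverts ?_
  funext u v
  refine propext ⟨fun hD => ?_, fun hD => ?_⟩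
  · exact (key u v (D.mem_verts u v hD).1 (D.mem_verts u v hD).2).mp hD
  · have := D'.mem_verts u v hD
    rw [← hverts] at this
    exact (key u v this.1 this.2).mpr hD

/-- If the rows of all members of `F` satisfy `Q`, then the expected size of `F` is at most the
product of the weights of `Q`. -/
lemma expectExt_ncard_le [Fintype V] {p : ℝ} (h0 : 0 ≤ p) (h1 : p ≤ 1) (H : OrientedGraph V)
    (A : Finset V) (hA : Disjoint A H.verts) (F : FinGraph V → Set (OrientedGraph V))
    (Q : (V → SignType) → Prop)
    (hF : ∀ S, ∀ D ∈ F (H.underlying.extend A S), IsExtension (H.underlying.extend A S) H D ∧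
      ∀ a ∈ A, Q (rowPattern A H.verts D a)) :
    expectExt A H.underlying p (fun G => ((F G).ncard : ℝ)) ≤
      ∏ a ∈ A, patternSum p (rowSupport A H.verts a) Q := by
  classical
  set I : Finset ((_ : Finset (Sym2 V)) × OrientedGraph V) :=
    (newPairs A H.verts).powerset.sigma fun S =>
      (Set.toFinite (F (H.underlying.extend A S))).toFinset with hI
  have hmem : ∀ q ∈ I, q.1 ⊆ newPairs A H.verts ∧ q.2 ∈ F (H.underlying.extend A q.1) := by
    intro q hq
    rw [hI, Finset.mem_sigma, Finset.mem_powerset, Set.Finite.mem_toFinset] at hq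
    exact hq
  set g : (∀ a ∈ A, V → SignType) → ℝ := fun τ => ∏ a ∈ A.attach,
    if Q (τ a.1 a.2) then
      ∏ x ∈ rowSupport A H.verts a.1, edgeWeight p (τ a.1 a.2 x) else 0 with hg
  set e : ((_ : Finset (Sym2 V)) × OrientedGraph V) → ∀ a ∈ A, V → SignType :=
    fun q a _ => rowPattern A H.verts q.2 a with he
  -- The rows determine D, and D determines S, so no tuple of rows is counted twice.
  have hinj : Set.InjOn e I := by
    rintro ⟨S, D⟩ hq ⟨S', D'⟩ hq' heq
    have m := hmem _ hq
    have m' := hmem _ hq'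
    have hD : D = D' := by
      refine (hF S D m.2).1.ext_rows (hF S' D' m'.2).1 fun a ha => ?_
      exact congrFun (congrFun heq a) ha
    subst hD
    have hS : S = S' := by
      ext t
      have : t ∈ newPairs A H.verts → (t ∈ S ↔ t ∈ S') := by
        induction t using Sym2.ind with
        | _ u v =>
        intro ht
        rw [(hF S D m.2).1.mem_iff ht, (hF S' D m'.2).1.mem_iff ht]
      exact ⟨fun h => (this (m.1 h)).mp h, fun h => (this (m'.1 h)).mpr h⟩
    subst hS
    rfl
  calc expectExt A H.underlying p (fun G => ((F G).ncard : ℝ))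
      = ∑ q ∈ I, p ^ q.1.card * (1 - p) ^ ((newPairs A H.verts).card - q.1.card) := by
        rw [hI, Finset.sum_sigma]
        refine Finset.sum_congr rfl fun S _ => ?_
        dsimp only
        rw [Finset.sum_const, nsmul_eq_mul, mul_comm, Set.ncard_eq_toFinset_card _ (Set.toFinite _)]
        rfl
    _ = ∑ q ∈ I, g (e q) := by
        refine Finset.sum_congr rfl fun q hq => ?_
        have m := hmem _ hq
        have hx := hF _ _ m.2
        rw [hx.1.weight_eq hA m.1, hg, ← Finset.prod_attach]
        exact Finset.prod_congr rfl fun a _ => (if_pos (hx.2 a.1 a.2)).symm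
    _ = ∑ τ ∈ I.image e, g τ := (Finset.sum_image hinj).symm
    -- Passing from realised tuples to all tuples only adds nonnegative terms, and the sum now
    -- factorises.
    _ ≤ ∑ τ ∈ A.pi fun a => signPatterns (rowSupport A H.verts a), g τ := by
        refine Finset.sum_le_sum_of_subset_of_nonneg ?_ fun τ _ _ => ?_
        · intro τ hτ
          obtain ⟨q, _, rfl⟩ := Finset.mem_image.mp hτ
          exact Finset.mem_pi.mpr fun a _ => rowPattern_mem _ _ _ _
        · refine Finset.prod_nonneg fun a _ => ?_
          split_ifs
          · exact Finset.prod_nonneg fun x _ => edgeWeight_nonneg h0 h1 _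
          · exact le_rfl
    _ = _ := by
        unfold patternSum
        rw [Finset.prod_sum]

end Rows

/-! ### Paths and cycles through a new vertex. -/

section Paths

variable {V : Type*}

lemma OrientedGraph.power_adj_mono {D D' : OrientedGraph V} (h : ∀ u v, D.Adj u v → D'.Adj u v)
    {r : ℕ} {u v : V} (huv : (D.power r).Adj u v) : (D'.power r).Adj u v := by
  obtain ⟨f, hf, h1, h2, h3⟩ := huv
  exact ⟨f, hf, h1, h2, fun i => h _ _ (h3 i)⟩

/-- The vertices of a path with at least one edge are vertices of the graph. -/
lemma OrientedGraph.path_mem_verts {D : OrientedGraph V} {r : ℕ} (hr : 1 ≤ r)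
    {f : Fin (r + 1) → V} (h : ∀ i : Fin r, D.Adj (f i.castSucc) (f i.succ)) (j : Fin (r + 1)) :
    f j ∈ D.verts := by
  induction j using Fin.cases with
  | zero =>
    have := (D.mem_verts _ _ (h ⟨0, hr⟩)).1
    exact this
  | succ i => exact (D.mem_verts _ _ (h i)).2

/-- Prepending a vertex to a path. -/
lemma OrientedGraph.power_succ_of_adj_left {D D' : OrientedGraph V} {r : ℕ} (hr : 1 ≤ r)
    (hsub : ∀ u v, D'.Adj u v → D.Adj u v) {a x b : V} (ha : a ∉ D'.verts) (hax : D.Adj a x)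
    (hxb : (D'.power r).Adj x b) : (D.power (r + 1)).Adj a b := by
  obtain ⟨f, hf, rfl, rfl, h3⟩ := hxb
  refine ⟨Fin.cons a f, ?_, rfl, ?_, ?_⟩
  · refine Fin.cons_injective_iff.mpr ⟨?_, hf⟩
    rintro ⟨j, rfl⟩
    exact ha (D'.path_mem_verts hr h3 j)
  · rw [← Fin.succ_last, Fin.cons_succ]
  · intro i
    induction i using Fin.cases with
    | zero => simpa using hax
    | succ i =>
      rw [← Fin.succ_castSucc, Fin.cons_succ, Fin.cons_succ]
      exact hsub _ _ (h3 i)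

/-- Appending a vertex to a path. -/
lemma OrientedGraph.power_succ_of_adj_right {D D' : OrientedGraph V} {r : ℕ} (hr : 1 ≤ r)
    (hsub : ∀ u v, D'.Adj u v → D.Adj u v) {a x b : V} (ha : a ∉ D'.verts) (hxa : D.Adj x a)
    (hbx : (D'.power r).Adj b x) : (D.power (r + 1)).Adj b a := by
  obtain ⟨f, hf, rfl, rfl, h3⟩ := hbx
  refine ⟨Fin.snoc (α := fun _ => V) f a, ?_, ?_, by simp, ?_⟩
  · refine Fin.snoc_injective_iff.mpr ⟨hf, ?_⟩
    rintro ⟨j, rfl⟩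
    exact ha (D'.path_mem_verts hr h3 j)
  · rw [← Fin.castSucc_zero, Fin.snoc_castSucc]
  · intro i
    induction i using Fin.lastCases with
    | last => simpa using hxa
    | cast i =>
      rw [← Fin.castSucc_succ, Fin.snoc_castSucc, Fin.snoc_castSucc]
      exact hsub _ _ (h3 i)

/-- A path closed up by a new vertex is a cycle. -/
lemma OrientedGraph.not_cycleFree_of_power {D D' : OrientedGraph V} {r : ℕ} (hr : 1 ≤ r)
    (hsub : ∀ u v, D'.Adj u v → D.Adj u v) {a x y : V} (ha : a ∉ D'.verts) (hax : D.Adj a x)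
    (hya : D.Adj y a) (hxy : (D'.power r).Adj x y) : ¬ D.CycleFree r := by
  obtain ⟨f, hf, rfl, rfl, h3⟩ := hxy
  refine fun h => h ⟨Fin.cons a f, ?_, ?_⟩
  · refine Fin.cons_injective_iff.mpr ⟨?_, hf⟩
    rintro ⟨j, rfl⟩
    exact ha (D'.path_mem_verts hr h3 j)
  · intro i
    -- Three kinds of arcs: the one leaving a, those of the path, and the one returning to a, where
    -- the cyclic successor wraps to 0.
    induction i using Fin.cases with
    | zero =>
      have : (0 : Fin (r + 2)) + 1 = Fin.succ 0 := by rw [zero_add, Fin.succ_zero_eq_one]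
      rw [this, Fin.cons_succ, Fin.cons_zero]
      exact hax
    | succ i =>
      induction i using Fin.lastCases with
      | last =>
        have : (Fin.last r).succ + 1 = 0 := by rw [Fin.succ_last, Fin.last_add_one]
        rw [this, Fin.cons_succ, Fin.cons_zero]
        exact hya
      | cast i =>
        have : i.castSucc.succ + 1 = i.succ.succ := by
          rw [Fin.succ_castSucc, Fin.coeSucc_eq_succ]
        rw [this, Fin.cons_succ, Fin.cons_succ]
        exact hsub _ _ (h3 i)

end Paths

/-! ### What local density of an extension says about H. -/

lemma OrientedGraph.left_mem_of_power {V : Type*} {D : OrientedGraph V} {r : ℕ} (hr : 1 ≤ r)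
    {u v : V} (h : (D.power r).Adj u v) : u ∈ D.verts := by
  obtain ⟨f, _, rfl, _, h3⟩ := h
  exact D.path_mem_verts hr h3 0

lemma OrientedGraph.right_mem_of_power {V : Type*} {D : OrientedGraph V} {r : ℕ} (hr : 1 ≤ r)
    {u v : V} (h : (D.power r).Adj u v) : v ∈ D.verts := by
  obtain ⟨f, _, _, rfl, h3⟩ := h
  exact D.path_mem_verts hr h3 _

/-- Once A is deleted, only arcs of H are left. This transfers local density from a single extension
to H. -/
lemma IsExtension.power_delete_eq {V : Type*} [LinearOrder V] {H D : OrientedGraph V}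
    {A : Finset V} {S : Finset (Sym2 V)} (hA : Disjoint A H.verts)
    (h : IsExtension (H.underlying.extend A S) H D) (X : Finset V) (r : ℕ) :
    (D.delete (X ∪ A)).power r = (H.delete X).power r := by
  ext u v
  refine ⟨OrientedGraph.power_adj_mono ?_, OrientedGraph.power_adj_mono ?_⟩
  · rintro u v ⟨hD, hu, hv⟩
    have m := D.mem_verts u v hD
    rw [h.verts_eq] at m
    simp only [Finset.mem_union, not_or] at m hu hv
    exact ⟨(h.adj_iff (by tauto) (by tauto)).mp hD, hu.1, hv.1⟩
  · rintro u v ⟨hH, hu, hv⟩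
    have m := H.mem_verts u v hH
    refine ⟨h.2 _ _ hH, ?_, ?_⟩ <;> rw [Finset.mem_union, not_or]
    · exact ⟨hu, fun ha => Finset.disjoint_left.mp hA ha m.1⟩
    · exact ⟨hv, fun ha => Finset.disjoint_left.mp hA ha m.2⟩

open Classical in
lemma edgesBetween_eq_sum_left {V : Type*} (G : Digraph V) (S T : Finset V) :
    edgesBetween G S T =
      ∑ a ∈ S, ((T.filter fun b => G.Adj a b).card + (T.filter fun b => G.Adj b a).card) := by
  unfold edgesBetween
  simp only [Finset.card_filter]
  rw [Finset.sum_product, Finset.sum_product, ← Finset.sum_add_distrib]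

open Classical in
lemma edgesBetween_eq_sum_right {V : Type*} (G : Digraph V) (S T : Finset V) :
    edgesBetween G S T =
      ∑ b ∈ T, ((S.filter fun a => G.Adj a b).card + (S.filter fun a => G.Adj b a).card) := by
  unfold edgesBetween
  simp only [Finset.card_filter]
  rw [Finset.sum_product_right, Finset.sum_product_right, ← Finset.sum_add_distrib]

/-- A `k`-locally dense extension forces vertices of `H` to have many new neighbours in `B`. -/
lemma exists_large_neighborhood {ℓ n k : ℕ} {p : ℝ} (hk : 1 ≤ k) (hkℓ : k + 1 ≤ ℓ) (hp0 : 0 < p)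
    (hp1 : p ≤ 1) (hx : p ^ (1 / (ℓ : ℝ)) * (128 * ℓ) ≤ 1) (hα : 0 < alpha n p)
    {H D : OrientedGraph (Fin n)} {A B X : Finset (Fin n)} {S : Finset (Sym2 (Fin n))}
    (hD : IsExtension (H.underlying.extend A S) H D) (hdense : LocallyDense ℓ p k D)
    (hframe : IsFrame ℓ p (k + 1) A H.verts B X) {f g : Fin n → Finset (Fin n)}
    (hf : ∀ v b, b ∈ B → ((H.delete X).power k).Adj v b → b ∈ f v)
    (hg : ∀ v b, b ∈ B → ((H.delete X).power k).Adj b v → b ∈ g v)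
    {U U' : Finset (Fin n)}
    (hU : (U.card : ℝ) + U'.card ≤ p ^ (((ℓ : ℝ) - (k + 1 : ℕ) + 1) / ℓ) * B.card)
    {C : Finset (Fin n)} (hC : C ⊆ H.verts \ (B ∪ X)) (hCα : alpha n p ≤ C.card) :
    ∃ v ∈ C, p ^ (((ℓ : ℝ) - k + 1) / ℓ) * B.card / 8 ≤ (f v \ U).card ∨
      p ^ (((ℓ : ℝ) - k + 1) / ℓ) * B.card / 8 ≤ (g v \ U').card := by
  classical
  by_contra! hcon
  obtain ⟨hA, hBW, hXW, hBX, hAα, hB1, hB2, hXc⟩ := hframe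
  obtain ⟨A', hA'C, hA'⟩ := Finset.exists_subset_card_eq hCα
  have hℓ0 : (0 : ℝ) < ℓ := by exact_mod_cast (by omega : 0 < ℓ)
  have hα' : (0 : ℝ) < alpha n p := by exact_mod_cast hα
  set G := (H.delete X).power k with hG
  set y := p ^ (((ℓ : ℝ) - k + 1) / ℓ) with hy
  have hy0 : 0 < y := Real.rpow_pos_of_pos hp0 _
  -- Since k + 1 ≤ ℓ, the exponent is at least 1/ℓ, so `hx` applies.
  have hM : p ^ (((ℓ : ℝ) - (k + 1 : ℕ) + 1) / ℓ) * (128 * ℓ) ≤ 1 := by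
    refine le_trans (mul_le_mul_of_nonneg_right ?_ (by positivity)) hx
    refine Real.rpow_le_rpow_of_exponent_ge hp0 hp1 ?_
    have : ((k + 1 : ℕ) : ℝ) ≤ ℓ := by exact_mod_cast hkℓ
    gcongr
    linarith
  have hB1' : ((k : ℝ) + 1) * alpha n p ≤ B.card := by exact_mod_cast hB1
  have hB2' : (B.card : ℝ) ≤ ℓ * alpha n p := by exact_mod_cast hB2
  have hk' : (1 : ℝ) ≤ k := by exact_mod_cast hk
  set z := p ^ (((ℓ : ℝ) - (k + 1 : ℕ) + 1) / ℓ) with hz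
  have hz0 : 0 ≤ z := Real.rpow_nonneg hp0.le _
  have hzB : z * B.card * 128 ≤ alpha n p := by
    have : z * B.card * 128 ≤ z * (ℓ * alpha n p) * 128 := by gcongr
    nlinarith
  -- At most α/128 elements are removed, so B' keeps kα of the at least (k + 1)α elements of B, and
  -- at least half of B.
  set B' := B \ (U ∪ U') with hB'
  have hB'c : (B.card : ℝ) ≤ B'.card + (U.card + U'.card) := by
    have h1 : B.card ≤ B'.card + (U ∪ U').card := by
      rw [hB']; have := Finset.le_card_sdiff (U ∪ U') B; omega
    have h2 := Finset.card_union_le U U'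
    exact_mod_cast h1.trans (by omega)
  have hB'k : k * alpha n p ≤ B'.card := by
    have : (k : ℝ) * alpha n p ≤ B'.card := by nlinarith
    exact_mod_cast this
  have hB'half : (B.card : ℝ) ≤ 2 * B'.card := by nlinarith
  have hB'B : B' ⊆ B := Finset.sdiff_subset
  have hA'W : ∀ v ∈ A', v ∈ H.verts ∧ v ∉ B ∧ v ∉ X := by
    intro v hv
    have := hC (hA'C hv)
    simpa only [Finset.mem_sdiff, Finset.mem_union, not_or] using this
  have hdis := Finset.disjoint_left.mp hA
  -- Deleting A costs α/2 more vertices, and passing from k + 1 to k raises the allowance by α.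
  have hXA : (X ∪ A).card ≤ (ℓ + 1 - k) * alpha n p := by
    have h1 := Finset.card_union_le X A
    have h2 : ℓ + 1 - k = (ℓ + 1 - (k + 1)) + 1 := by omega
    rw [h2, add_mul]
    omega
  have hlow := hdense A' B' (X ∪ A)
    (by rw [hD.verts_eq]; exact fun v hv => Finset.mem_union_right _ (hA'W v hv).1)
    (by rw [hD.verts_eq]; exact fun v hv => Finset.mem_union_right _ (hBW (hB'B hv)))
    (by
      rw [hD.verts_eq, Finset.union_comm]
      exact Finset.union_subset_union_right hXW)
    (Finset.disjoint_left.mpr fun v hv hvB => (hA'W v hv).2.1 (hB'B hvB))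
    (Finset.disjoint_left.mpr fun v hv hvX => by
      rcases Finset.mem_union.mp hvX with h | h
      · exact (hA'W v hv).2.2 h
      · exact hdis h (hA'W v hv).1)
    (Finset.disjoint_left.mpr fun v hv hvX => by
      rcases Finset.mem_union.mp hvX with h | h
      · exact Finset.disjoint_left.mp hBX (hB'B hv) h
      · exact hdis h (hBW (hB'B hv)))
    hA' hB'k ((Finset.card_le_card hB'B).trans hB2) hXA
  rw [hD.power_delete_eq hA, ← hG, ← hy, edgesBetween_eq_sum_left, hA'] at hlow
  push_cast at hlow
  -- The origin of the 8: two directions give less than 2 · y|B|/8 per vertex, while density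
  -- requires y|B'|/2 ≥ y|B|/4 on average.
  have hup : ∑ a ∈ A', (((B'.filter fun b => G.Adj a b).card : ℝ) +
      (B'.filter fun b => G.Adj b a).card) < ∑ _a ∈ A', y * B.card / 4 := by
    refine Finset.sum_lt_sum_of_nonempty (Finset.card_pos.mp (by omega)) fun a ha => ?_
    have h1 : (B'.filter fun b => G.Adj a b).card ≤ (f a \ U).card := by
      refine Finset.card_le_card fun b hb => ?_
      simp only [hB', Finset.mem_filter, Finset.mem_sdiff, Finset.mem_union, not_or] at hb ⊢
      exact ⟨hf a b hb.1.1 hb.2, hb.1.2.1⟩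
    have h2 : (B'.filter fun b => G.Adj b a).card ≤ (g a \ U').card := by
      refine Finset.card_le_card fun b hb => ?_
      simp only [hB', Finset.mem_filter, Finset.mem_sdiff, Finset.mem_union, not_or] at hb ⊢
      exact ⟨hg a b hb.1.1 hb.2, hb.1.2.2⟩
    have h3 := hcon a (hA'C ha)
    have h1' : ((B'.filter fun b => G.Adj a b).card : ℝ) ≤ (f a \ U).card := by exact_mod_cast h1
    have h2' : ((B'.filter fun b => G.Adj b a).card : ℝ) ≤ (g a \ U').card := by exact_mod_cast h2
    linarith
  rw [Finset.sum_const, hA', nsmul_eq_mul] at hup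
  have : y * alpha n p * B.card ≤ y * alpha n p * (2 * B'.card) := by gcongr
  nlinarith

open Classical in
/-- An `ℓ`-locally dense extension forces large sets of vertices of `H` to contain a vertex of
large out- or indegree in the `ℓ`-th power. -/
lemma exists_large_degree {ℓ n : ℕ} {p : ℝ} (hℓ : 1 ≤ ℓ) (hp0 : 0 < p) (hα : 0 < alpha n p)
    {H D : OrientedGraph (Fin n)} {A : Finset (Fin n)} {S : Finset (Sym2 (Fin n))}
    (hA : Disjoint A H.verts) (hAα : 2 * A.card = alpha n p)
    (hD : IsExtension (H.underlying.extend A S) H D) (hdense : LocallyDense ℓ p ℓ D)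
    {C : Finset (Fin n)} (hC : C ⊆ H.verts) (hCα : 12 * ℓ * alpha n p ≤ C.card) :
    ∃ v ∈ C, p ^ (1 / (ℓ : ℝ)) / 5 * (C.card + 1) ≤
        (C.filter fun y => ((H.delete ∅).power ℓ).Adj v y ∧ y ≠ v).card ∨
      p ^ (1 / (ℓ : ℝ)) / 5 * (C.card + 1) ≤
        (C.filter fun y => ((H.delete ∅).power ℓ).Adj y v ∧ y ≠ v).card := by
  by_contra! hcon
  have hαC : alpha n p ≤ C.card := by nlinarith
  obtain ⟨A', hA'C, hA'⟩ := Finset.exists_subset_card_eq hαC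
  have hα' : (0 : ℝ) < alpha n p := by exact_mod_cast hα
  have hα2 : 2 ≤ alpha n p := by omega
  have hℓ' : (1 : ℝ) ≤ ℓ := by exact_mod_cast hℓ
  set G := (H.delete ∅).power ℓ with hG
  set x := p ^ (1 / (ℓ : ℝ)) with hx
  have hx0 : 0 < x := Real.rpow_pos_of_pos hp0 _
  have hdis := Finset.disjoint_left.mp hA
  set T := C \ A' with hT
  have hTC : T ⊆ C := Finset.sdiff_subset
  have hTcard : (T.card : ℝ) + alpha n p = C.card := by
    rw [← hA']
    exact_mod_cast Finset.card_sdiff_add_card_eq_card hA'C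
  set d : Fin n → ℕ := fun b =>
    (A'.filter fun a => G.Adj a b).card + (A'.filter fun a => G.Adj b a).card with hd
  set L := T.filter fun b => (d b : ℝ) < 1 / 2 * x * alpha n p with hL
  -- For r = ℓ, density speaks only of sets B with exactly ℓα elements; a larger L would contain one
  -- that violates it.
  have hLc : L.card ≤ ℓ * alpha n p := by
    by_contra! hlt
    obtain ⟨B, hBL, hB⟩ := Finset.exists_subset_card_eq hlt.le
    have hBT : B ⊆ T := hBL.trans (Finset.filter_subset _ _)
    have hlow := hdense A' B (∅ ∪ A)
      (by rw [hD.verts_eq]; exact fun v hv => Finset.mem_union_right _ (hC (hA'C hv)))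
      (by rw [hD.verts_eq]; exact fun v hv => Finset.mem_union_right _ (hC (hTC (hBT hv))))
      (by rw [hD.verts_eq, Finset.empty_union]; exact Finset.subset_union_left)
      (Finset.disjoint_left.mpr fun v hv hvB => (Finset.mem_sdiff.mp (hBT hvB)).2 hv)
      (Finset.disjoint_left.mpr fun v hv hvX => by
        rw [Finset.empty_union] at hvX
        exact hdis hvX (hC (hA'C hv)))
      (Finset.disjoint_left.mpr fun v hv hvX => by
        rw [Finset.empty_union] at hvX
        exact hdis hvX (hC (hTC (hBT hv))))
      hA' hB.ge hB.le
      (by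
        rw [Finset.empty_union, Nat.add_sub_cancel_left]
        omega)
    rw [hD.power_delete_eq hA, ← hG, edgesBetween_eq_sum_right, sub_self, zero_add, ← hx, hA']
      at hlow
    push_cast at hlow
    have hup : ∑ b ∈ B, (((A'.filter fun a => G.Adj a b).card : ℝ) +
        (A'.filter fun a => G.Adj b a).card) < ∑ _b ∈ B, 1 / 2 * x * alpha n p := by
      refine Finset.sum_lt_sum_of_nonempty (Finset.card_pos.mp (by nlinarith)) fun b hb => ?_
      have := (Finset.mem_filter.mp (hBL hb)).2
      simpa [hd] using this
    rw [Finset.sum_const, nsmul_eq_mul] at hup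
    linarith
  have hlow : ((T.card : ℝ) - ℓ * alpha n p) * (1 / 2 * x * alpha n p) ≤
      (edgesBetween G A' T : ℝ) := by
    rw [edgesBetween_eq_sum_right]
    push_cast
    calc ((T.card : ℝ) - ℓ * alpha n p) * (1 / 2 * x * alpha n p)
        ≤ (T \ L).card * (1 / 2 * x * alpha n p) := by
          gcongr
          have h1 : T.card ≤ (T \ L).card + L.card := by
            have := Finset.le_card_sdiff L T; omega
          have h2 : (T.card : ℝ) ≤ (T \ L).card + L.card := by exact_mod_cast h1
          have h3 : (L.card : ℝ) ≤ ℓ * alpha n p := by exact_mod_cast hLc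
          linarith
      _ = ∑ _b ∈ T \ L, (1 / 2 * x * alpha n p) := by rw [Finset.sum_const, nsmul_eq_mul]
      _ ≤ ∑ b ∈ T \ L, (((A'.filter fun a => G.Adj a b).card : ℝ) +
          (A'.filter fun a => G.Adj b a).card) := by
          refine Finset.sum_le_sum fun b hb => ?_
          rw [Finset.mem_sdiff, hL, Finset.mem_filter, not_and, not_lt] at hb
          have := hb.2 hb.1
          simpa [hd] using this
      _ ≤ _ := Finset.sum_le_sum_of_subset_of_nonneg Finset.sdiff_subset
          fun _ _ _ => by positivity
  have hup : (edgesBetween G A' T : ℝ) < ∑ _a ∈ A', 2 * (x / 5 * (C.card + 1)) := by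
    rw [edgesBetween_eq_sum_left]
    push_cast
    refine Finset.sum_lt_sum_of_nonempty (Finset.card_pos.mp (by omega)) fun a ha => ?_
    have hne : ∀ y ∈ T, y ≠ a := by
      rintro y hy rfl
      exact (Finset.mem_sdiff.mp hy).2 ha
    have h1 : (T.filter fun b => G.Adj a b).card ≤
        (C.filter fun y => G.Adj a y ∧ y ≠ a).card := by
      refine Finset.card_le_card fun b hb => ?_
      rw [Finset.mem_filter] at hb ⊢
      exact ⟨hTC hb.1, hb.2, hne b hb.1⟩
    have h2 : (T.filter fun b => G.Adj b a).card ≤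
        (C.filter fun y => G.Adj y a ∧ y ≠ a).card := by
      refine Finset.card_le_card fun b hb => ?_
      rw [Finset.mem_filter] at hb ⊢
      exact ⟨hTC hb.1, hb.2, hne b hb.1⟩
    have h3 := hcon a (hA'C ha)
    have h1' : ((T.filter fun b => G.Adj a b).card : ℝ) ≤
        (C.filter fun y => G.Adj a y ∧ y ≠ a).card := by exact_mod_cast h1
    have h2' : ((T.filter fun b => G.Adj b a).card : ℝ) ≤
        (C.filter fun y => G.Adj y a ∧ y ≠ a).card := by exact_mod_cast h2
    linarith
  rw [Finset.sum_const, hA', nsmul_eq_mul] at hup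
  have hCα' : 12 * (ℓ : ℝ) * alpha n p ≤ C.card := by exact_mod_cast hCα
  have hα2' : (2 : ℝ) ≤ alpha n p := by exact_mod_cast hα2
  have h24 : (alpha n p : ℝ) ≤ ℓ * alpha n p := le_mul_of_one_le_left hα'.le hℓ'
  -- As |T| = |C| - α, this says |C|/10 ≥ (ℓ + 1)α/2 + 2/5. The constant 12 and α ≥ 2 just suffice,
  -- with equality at ℓ = 1, α = 2, |C| = 24.
  have key : 2 * (1 / 5 * ((C.card : ℝ) + 1)) ≤ ((T.card : ℝ) - ℓ * alpha n p) * (1 / 2) := by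
    linarith
  have := mul_le_mul_of_nonneg_right key (mul_pos hx0 hα').le
  linarith

/-! ### Numerical estimates -/

lemma rpow_one_div_mul_le {ℓ : ℕ} (hℓ : 1 ≤ ℓ) {p : ℝ} (hp0 : 0 < p)
    (hp : p ≤ 1 / ((2 : ℝ) ^ 7 * ℓ) ^ ℓ) : p ^ (1 / (ℓ : ℝ)) * (128 * ℓ) ≤ 1 := by
  have hℓ0 : (0 : ℝ) < ℓ := by exact_mod_cast hℓ
  have h1 : p ^ (1 / (ℓ : ℝ)) ≤ (1 / ((2 : ℝ) ^ 7 * ℓ) ^ ℓ) ^ (1 / (ℓ : ℝ)) :=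
    Real.rpow_le_rpow hp0.le hp (by positivity)
  have h2 : (1 / ((2 : ℝ) ^ 7 * ℓ) ^ ℓ) ^ (1 / (ℓ : ℝ)) = 1 / (2 ^ 7 * ℓ) := by
    rw [← one_div_pow, one_div (ℓ : ℝ), Real.pow_rpow_inv_natCast (by positivity) (by omega)]
  rw [h2] at h1
  calc p ^ (1 / (ℓ : ℝ)) * (128 * ℓ) ≤ 1 / (2 ^ 7 * ℓ) * (128 * ℓ) := by gcongr
    _ = 1 := by field_simp; norm_num

lemma le_of_le_one_div_pow {ℓ : ℕ} (hℓ : 1 ≤ ℓ) {p : ℝ}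
    (hp : p ≤ 1 / ((2 : ℝ) ^ 7 * ℓ) ^ ℓ) : p ≤ 1 / 128 := by
  have hℓ0 : (1 : ℝ) ≤ ℓ := by exact_mod_cast hℓ
  refine hp.trans (one_div_le_one_div_of_le (by norm_num) ?_)
  have h : (128 : ℝ) ≤ 2 ^ 7 * ℓ := by linarith
  exact h.trans (le_self_pow₀ (by linarith) (by omega))

lemma two_le_of_alpha_pos {n : ℕ} {p : ℝ} (hα : 0 < alpha n p) : 2 ≤ n := by
  by_contra! h
  interval_cases n <;> simp [alpha] at hα

lemma mul_alpha_le {n : ℕ} {p : ℝ} (hn : 2 ≤ n) (hp0 : 0 < p) (hp : p ≤ 1 / 128) :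
    p * alpha n p ≤ 65 * Real.log n := by
  have h2 : Real.log 2 ≤ Real.log n := Real.log_le_log (by norm_num) (by exact_mod_cast hn)
  have := Real.log_two_gt_d9
  have hc : (⌈2 ^ 5 * Real.log n / p⌉₊ : ℝ) < 2 ^ 5 * Real.log n / p + 1 :=
    Nat.ceil_lt_add_one (by positivity)
  have hm : p * (2 ^ 5 * Real.log n / p + 1) = 2 ^ 5 * Real.log n + p := by field_simp
  have := mul_lt_mul_of_pos_left hc hp0
  unfold alpha
  push_cast
  linarith

/-- From 2⁵(log n)/p ≤ n and p ≤ 1/128 follows n ≥ 2¹² log 2 > 2048. In (ii) this lets (log n)²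
absorb a term linear in log n. -/
lemma log_ge_of_alpha_le {n : ℕ} {p : ℝ} (hn : 2 ≤ n) (hp0 : 0 < p) (hp : p ≤ 1 / 128)
    (h : alpha n p ≤ 2 * n) : 7 ≤ Real.log n := by
  have h2 : Real.log 2 ≤ Real.log n := Real.log_le_log (by norm_num) (by exact_mod_cast hn)
  have hl := Real.log_two_gt_d9
  have hc : 2 ^ 5 * Real.log n / p ≤ n := by
    refine (Nat.le_ceil _).trans ?_
    unfold alpha at h
    exact_mod_cast (by omega : ⌈2 ^ 5 * Real.log n / p⌉₊ ≤ n)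
  rw [div_le_iff₀ hp0] at hc
  have hn' : (2048 : ℝ) ≤ n := by
    have : (n : ℝ) * p ≤ n * (1 / 128) := by gcongr
    linarith
  have : Real.log 2048 ≤ Real.log n := Real.log_le_log (by norm_num) hn'
  have e : Real.log 2048 = 11 * Real.log 2 := by
    rw [show (2048 : ℝ) = 2 ^ 11 by norm_num, Real.log_pow]; norm_num
  linarith

lemma one_add_pow_le_exp {p : ℝ} (hp0 : 0 ≤ p) (N : ℕ) : (1 + p) ^ N ≤ Real.exp (p * N) := by
  rw [mul_comm, Real.exp_nat_mul]
  gcongr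
  linarith [Real.add_one_le_exp p]

lemma add_one_rpow_le_exp {m n : ℕ} (h : m + 1 ≤ n) {s : ℝ} (hs : 0 ≤ s) :
    ((m : ℝ) + 1) ^ s ≤ Real.exp (Real.log n * s) := by
  have hn : (0 : ℝ) < n := by exact_mod_cast (by omega : 0 < n)
  rw [← Real.rpow_def_of_pos hn]
  exact Real.rpow_le_rpow (by positivity) (by exact_mod_cast h) hs

lemma prod_le_exp {V : Type*} {A : Finset V} {f : V → ℝ} {c : ℝ} (h0 : ∀ a ∈ A, 0 ≤ f a)
    (h : ∀ a ∈ A, f a ≤ Real.exp c) : ∏ a ∈ A, f a ≤ Real.exp (A.card * c) := by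
  refine (Finset.prod_le_prod h0 h).trans ?_
  rw [Finset.prod_const, Real.exp_nat_mul]

/-- A vertex of A lies outside W, which makes room for the + 1 in the base of the branching bounds.
-/
lemma card_add_one_le {n : ℕ} {A W C : Finset (Fin n)} (hA : Disjoint A W) (hA0 : 0 < A.card)
    (hC : C ⊆ W) : C.card + 1 ≤ n := by
  have h1 := Finset.card_le_univ (A ∪ W)
  rw [Finset.card_union_of_disjoint hA, Fintype.card_fin] at h1
  have := Finset.card_le_card hC
  omega

lemma expectExt_le_one_of_empty {n : ℕ} {p : ℝ} (h0 : 0 ≤ p) (h1 : p ≤ 1)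
    (H : OrientedGraph (Fin n)) (F : FinGraph (Fin n) → Set (OrientedGraph (Fin n)))
    (hF : ∀ S, ∀ D ∈ F (H.underlying.extend ∅ S),
      IsExtension (H.underlying.extend ∅ S) H D) :
    expectExt ∅ H.underlying p (fun G => ((F G).ncard : ℝ)) ≤ 1 := by
  have := expectExt_ncard_le h0 h1 H ∅ (Finset.disjoint_empty_left _) F (fun _ => True)
    fun S D hD => ⟨hF S D hD, fun _ _ => trivial⟩
  simpa using this

lemma expectExt_eq_zero {n : ℕ} {p : ℝ} (H : OrientedGraph (Fin n)) (A : Finset (Fin n))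
    (F : FinGraph (Fin n) → Set (OrientedGraph (Fin n)))
    (hF : ∀ S, F (H.underlying.extend A S) = ∅) :
    expectExt A H.underlying p (fun G => ((F G).ncard : ℝ)) = 0 :=
  Finset.sum_eq_zero fun S _ => by simp [hF S]

/-! ### Row constraints and the two expectation bounds. -/

open Classical in
/-- Orientations of sparse extensions have rows that cover little. -/
lemma coverLE_of_mem_sparseExtensions {ℓ n k : ℕ} {p : ℝ} (hk : 1 ≤ k)
    {H D : OrientedGraph (Fin n)} {A B X : Finset (Fin n)} {S : Finset (Sym2 (Fin n))}
    (hA : Disjoint A H.verts) (hX : X ⊆ H.verts)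
    (hD : D ∈ sparseExtensions ℓ p (k + 1) (H.underlying.extend A S) H B X) {a : Fin n}
    (ha : a ∈ A) :
    CoverLE (fun v => B.filter fun b => ((H.delete X).power k).Adj v b)
      (fun v => B.filter fun b => ((H.delete X).power k).Adj b v)
      (p ^ (((ℓ : ℝ) - (k + 1 : ℕ) + 1) / ℓ) * B.card) ∅ ∅ (rowPattern A H.verts D a) := by
  have haH : a ∉ H.verts := Finset.disjoint_left.mp hA ha
  have haX : a ∉ X := fun h => haH (hX h)
  have haD : a ∉ (H.delete X).verts := fun h => haH (Finset.mem_sdiff.mp h).1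
  have hsub : ∀ u v, (H.delete X).Adj u v → (D.delete X).Adj u v :=
    fun u v h => ⟨hD.1.2 _ _ h.1, h.2⟩
  have hs := hD.2 a (Finset.mem_sdiff.mpr ⟨Finset.mem_union_left _ ha, haH⟩)
  rw [edgesBetween_eq_sum_left, Finset.sum_singleton, Nat.cast_add] at hs
  refine le_trans (add_le_add ?_ ?_) hs
  · refine Nat.cast_le.mpr (Finset.card_le_card fun b hb => ?_)
    simp only [Finset.empty_union, Finset.mem_biUnion, Finset.mem_filter, Finset.mem_univ,
      true_and] at hb ⊢
    obtain ⟨x, hx, hbB, hxb⟩ := hb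
    have hxX := (Finset.mem_sdiff.mp (OrientedGraph.left_mem_of_power hk hxb)).2
    exact ⟨hbB, OrientedGraph.power_succ_of_adj_left hk hsub haD
      ⟨adj_of_rowPattern_eq_one hx, haX, hxX⟩ hxb⟩
  · refine Nat.cast_le.mpr (Finset.card_le_card fun b hb => ?_)
    simp only [Finset.empty_union, Finset.mem_biUnion, Finset.mem_filter, Finset.mem_univ,
      true_and] at hb ⊢
    obtain ⟨x, hx, hbB, hxb⟩ := hb
    have hxX := (Finset.mem_sdiff.mp (OrientedGraph.right_mem_of_power hk hxb)).2
    exact ⟨hbB, OrientedGraph.power_succ_of_adj_right hk hsub haD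
      ⟨adj_of_rowPattern_eq_neg_one hx, hxX, haX⟩ hxb⟩

/-- Rows of orientations without directed cycles of length `ℓ + 2` are separated in the `ℓ`-th
power. -/
lemma separated_of_cycleFree {ℓ n : ℕ} (hℓ : 1 ≤ ℓ) {H D : OrientedGraph (Fin n)}
    {A : Finset (Fin n)} (hA : Disjoint A H.verts) (hHD : ∀ u v, H.Adj u v → D.Adj u v)
    (hD : D.CycleFree ℓ) {a : Fin n} (ha : a ∈ A) :
    Separated ((H.delete ∅).power ℓ).Adj (rowPattern A H.verts D a) := by
  intro x y hx hy hxy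
  refine OrientedGraph.not_cycleFree_of_power (D' := H.delete ∅) hℓ (fun u v h => hHD u v h.1)
    (fun h => Finset.disjoint_left.mp hA ha (Finset.mem_sdiff.mp h).1)
    (adj_of_rowPattern_eq_one hx) (adj_of_rowPattern_eq_neg_one hy) hxy hD

lemma rowSupport_sdiff_subset {V : Type*} [LinearOrder V] (A W Y : Finset V) (a : V) :
    rowSupport A W a \ (W \ Y) ⊆ A ∪ Y := by
  intro v
  simp only [rowSupport, Finset.mem_sdiff, Finset.mem_union, Finset.mem_filter]
  tauto

/-- The expected number of sparse extensions that are locally dense in the previous power. -/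
lemma expectExt_dense_inter_sparse_le {ℓ n k : ℕ} (hk : 1 ≤ k) (hkℓ : k + 1 ≤ ℓ) {p : ℝ}
    (hp0 : 0 < p) (hp : p ≤ 1 / ((2 : ℝ) ^ 7 * ℓ) ^ ℓ) (H : OrientedGraph (Fin n))
    (A B X : Finset (Fin n)) (hframe : IsFrame ℓ p (k + 1) A H.verts B X) :
    expectExt A H.underlying p (fun G =>
      ((denseExtensions ℓ p k G (OrientedGraph.empty (Fin n)) ∩
        sparseExtensions ℓ p (k + 1) G H B X).ncard : ℝ)) ≤
      Real.exp (9 * (alpha n p : ℝ) * p ^ (-(1 / (ℓ : ℝ))) * Real.log n) := by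
  classical
  have hℓ : 1 ≤ ℓ := by omega
  have hp128 := le_of_le_one_div_pow hℓ hp
  have hp1 : p ≤ 1 := by linarith
  have hx := rpow_one_div_mul_le hℓ hp0 hp
  obtain ⟨hA, hBW, hXW, hBX, hAα, hB1, hB2, hXc⟩ := id hframe
  -- If α = 0, then A is empty and the claimed bound is exp 0 = 1.
  rcases Nat.eq_zero_or_pos (alpha n p) with hα | hα
  · have hA0 : A = ∅ := Finset.card_eq_zero.mp (by omega)
    subst hA0
    refine (expectExt_le_one_of_empty hp0.le hp1 H _ fun S D hD => hD.2.1).trans ?_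
    simp [hα]
  by_cases hex : ∃ S D, D ∈ denseExtensions ℓ p k (H.underlying.extend A S)
      (OrientedGraph.empty (Fin n)) ∩ sparseExtensions ℓ p (k + 1) (H.underlying.extend A S) H B X
  swap
  · push Not at hex
    rw [expectExt_eq_zero H A _ fun S => Set.eq_empty_of_forall_notMem (hex S)]
    positivity
  obtain ⟨S₀, D₀, hD₀⟩ := hex
  have hn := two_le_of_alpha_pos hα
  have hlog : 0 ≤ Real.log n := Real.log_natCast_nonneg n
  have hpα := mul_alpha_le hn hp0 hp128
  have hℓ0 : (1 : ℝ) ≤ ℓ := by exact_mod_cast hℓ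
  have hα' : (0 : ℝ) < alpha n p := by exact_mod_cast hα
  set f : Fin n → Finset (Fin n) := fun v => B.filter fun b => ((H.delete X).power k).Adj v b
  set g : Fin n → Finset (Fin n) := fun v => B.filter fun b => ((H.delete X).power k).Adj b v
  set M := p ^ (((ℓ : ℝ) - (k + 1 : ℕ) + 1) / ℓ) * B.card with hM
  set q := p ^ (((ℓ : ℝ) - k + 1) / ℓ) * B.card / 8 with hq
  have hB0 : 0 < B.card := lt_of_lt_of_le (by positivity) hB1
  have hB0' : (0 : ℝ) < B.card := by exact_mod_cast hB0
  have hz0 : 0 < p ^ (((ℓ : ℝ) - (k + 1 : ℕ) + 1) / ℓ) := Real.rpow_pos_of_pos hp0 _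
  have hM0 : 0 ≤ M := by positivity
  have hq0 : 0 < q := by have := Real.rpow_pos_of_pos hp0 (((ℓ : ℝ) - k + 1) / ℓ); positivity
  have hx0 : 0 < p ^ (1 / (ℓ : ℝ)) := Real.rpow_pos_of_pos hp0 _
  have hinv : p ^ (-(1 / (ℓ : ℝ))) = (p ^ (1 / (ℓ : ℝ)))⁻¹ := Real.rpow_neg hp0.le _
  have hMq : M / q = 8 * p ^ (-(1 / (ℓ : ℝ))) := by
    have e : p ^ (((ℓ : ℝ) - k + 1) / ℓ) =
        p ^ (((ℓ : ℝ) - (k + 1 : ℕ) + 1) / ℓ) * p ^ (1 / (ℓ : ℝ)) := by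
      rw [← Real.rpow_add hp0]
      congr 1
      push_cast
      ring
    rw [hinv, hM, hq, e]
    field_simp
  have hinvge : 128 * (ℓ : ℝ) ≤ p ^ (-(1 / (ℓ : ℝ))) := by
    rw [hinv, ← one_div, le_div_iff₀ hx0]
    linarith
  refine (expectExt_ncard_le hp0.le hp1 H A hA _ (CoverLE f g M ∅ ∅) fun S D hD =>
    ⟨hD.2.1, fun a ha => coverLE_of_mem_sparseExtensions hk hA hXW hD.2 ha⟩).trans ?_
  refine (prod_le_exp (c := 18 * p ^ (-(1 / (ℓ : ℝ))) * Real.log n)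
    (fun a _ => patternSum_nonneg hp0.le hp1 _ _) fun a ha => ?_).trans_eq ?_
  · have hrow := patternSum_coverLE_le hp0.le hp1 f g (H.verts \ (B ∪ X)) (alpha n p) (M := M) hq0
      (fun U U' hU C' hC' hCα => exists_large_neighborhood hk hkℓ hp0 hp1 hx hα hD₀.2.1 hD₀.1.2.2.2
        hframe (fun v b hb h => Finset.mem_filter.mpr ⟨hb, h⟩)
        (fun v b hb h => Finset.mem_filter.mpr ⟨hb, h⟩) hU hC' hCα)
      (rowSupport A H.verts a) ∅ ∅ (by simpa using hM0)
    simp only [Finset.card_empty, Nat.cast_zero, sub_zero] at hrow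
    refine hrow.trans ?_
    -- The vertices outside the branching: α at the end, plus A, B and X, where |X| ≤ (ℓ - 1)α.
    have hcard : alpha n p + (rowSupport A H.verts a \ (H.verts \ (B ∪ X))).card ≤
        3 * ℓ * alpha n p := by
      have h1 := Finset.card_le_card (rowSupport_sdiff_subset A H.verts (B ∪ X) a)
      have h2 := Finset.card_union_le A (B ∪ X)
      have h3 := Finset.card_union_le B X
      have h4 : (ℓ + 1 - (k + 1)) * alpha n p ≤ (ℓ - 1) * alpha n p :=
        Nat.mul_le_mul_right _ (by omega)
      have h5 : (ℓ - 1) * alpha n p + alpha n p = ℓ * alpha n p := by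
        rw [← Nat.succ_mul]; congr 1; omega
      have h6 : alpha n p ≤ ℓ * alpha n p := Nat.le_mul_of_pos_left _ hℓ
      have h7 : 3 * ℓ * alpha n p = 3 * (ℓ * alpha n p) := by ring
      omega
    have hcard' : ((alpha n p + (rowSupport A H.verts a \ (H.verts \ (B ∪ X))).card : ℕ) : ℝ) ≤
        3 * ℓ * alpha n p := by exact_mod_cast hcard
    have hm : (rowSupport A H.verts a ∩ (H.verts \ (B ∪ X))).card + 1 ≤ n :=
      card_add_one_le hA (by omega) (Finset.inter_subset_right.trans Finset.sdiff_subset)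
    refine (mul_le_mul (one_add_pow_le_exp hp0.le _)
      (add_one_rpow_le_exp hm (by positivity)) (by positivity) (by positivity)).trans ?_
    rw [← Real.exp_add, Real.exp_le_exp, hMq]
    -- With I = p^(-1/ℓ) ≥ 128ℓ, the leftover vertices give at most 3 · 65 ℓ log n ≤ 2I log n, and
    -- the branching gives (8I + 1) log n; the total is below 18I log n.
    have i1 := mul_le_mul_of_nonneg_left hcard' hp0.le
    have i2 := mul_le_mul_of_nonneg_left hpα (by positivity : (0 : ℝ) ≤ 3 * ℓ)
    have i3 := mul_le_mul_of_nonneg_right hinvge hlog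
    have i4 := mul_le_mul_of_nonneg_right hℓ0 hlog
    linarith
  · have : (2 : ℝ) * A.card = alpha n p := by exact_mod_cast hAα
    rw [← this]
    ring_nf

/-- The expected number of locally dense extensions without directed cycles of length `ℓ + 2`. -/
lemma expectExt_dense_le {ℓ n : ℕ} (hℓ : 1 ≤ ℓ) {p : ℝ} (hp0 : 0 < p)
    (hp : p ≤ 1 / ((2 : ℝ) ^ 7 * ℓ) ^ ℓ) (H : OrientedGraph (Fin n)) (A : Finset (Fin n))
    (hA : Disjoint A H.verts) (hAα : 2 * A.card = alpha n p) :
    expectExt A H.underlying p (fun G => ((denseExtensions ℓ p ℓ G H).ncard : ℝ)) ≤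
      Real.exp ((alpha n p : ℝ) * ((ℓ : ℝ) + 2) * p ^ (-(1 / (ℓ : ℝ))) * Real.log n ^ 2) := by
  classical
  have hp128 := le_of_le_one_div_pow hℓ hp
  have hp1 : p ≤ 1 := by linarith
  have hx := rpow_one_div_mul_le hℓ hp0 hp
  rcases Nat.eq_zero_or_pos (alpha n p) with hα | hα
  · have hA0 : A = ∅ := Finset.card_eq_zero.mp (by omega)
    subst hA0
    refine (expectExt_le_one_of_empty hp0.le hp1 H _ fun S D hD => hD.1).trans ?_
    simp [hα]
  by_cases hex : ∃ S D, D ∈ denseExtensions ℓ p ℓ (H.underlying.extend A S) H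
  swap
  · push Not at hex
    rw [expectExt_eq_zero H A _ fun S => Set.eq_empty_of_forall_notMem (hex S)]
    positivity
  obtain ⟨S₀, D₀, hD₀⟩ := hex
  have hn := two_le_of_alpha_pos hα
  have hpα := mul_alpha_le hn hp0 hp128
  have hA0 : 0 < A.card := by omega
  have hAn := Finset.card_le_univ A
  rw [Fintype.card_fin] at hAn
  have hlog := log_ge_of_alpha_le hn hp0 hp128 (by omega)
  have hℓ0 : (1 : ℝ) ≤ ℓ := by exact_mod_cast hℓ
  have hx0 : 0 < p ^ (1 / (ℓ : ℝ)) := Real.rpow_pos_of_pos hp0 _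
  have hinv : p ^ (-(1 / (ℓ : ℝ))) = (p ^ (1 / (ℓ : ℝ)))⁻¹ := Real.rpow_neg hp0.le _
  have hinvge : 128 * (ℓ : ℝ) ≤ p ^ (-(1 / (ℓ : ℝ))) := by
    rw [hinv, ← one_div, le_div_iff₀ hx0]
    linarith
  set I := p ^ (-(1 / (ℓ : ℝ))) with hI
  have hs : 1 ≤ 5 * I * Real.log n := by nlinarith
  -- The exponent is s = (log n)/δ with δ = p^(1/ℓ)/5.
  have hsN : 5 * I * Real.log n * (p ^ (1 / (ℓ : ℝ)) / 5) = Real.log n := by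
    rw [hinv]
    field_simp
  refine (expectExt_ncard_le hp0.le hp1 H A hA _ (Separated ((H.delete ∅).power ℓ).Adj)
    fun S D hD => ⟨hD.1, fun a ha =>
      separated_of_cycleFree hℓ hA hD.1.2 hD.2.2.1 ha⟩).trans ?_
  refine (prod_le_exp (c := 2 * (ℓ + 2) * I * Real.log n ^ 2)
    (fun a _ => patternSum_nonneg hp0.le hp1 _ _) fun a ha => ?_).trans_eq ?_
  · have hW := card_add_one_le hA hA0 (Finset.Subset.refl H.verts)
    have hrow := patternSum_separated_le hp0.le hp1 ((H.delete ∅).power ℓ).Adj H.verts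
      (12 * ℓ * alpha n p) hs (by exact_mod_cast hW) hsN
      (fun C' hC' hCα => exists_large_degree hℓ hp0 hα hA hAα hD₀.1 hD₀.2.2.2 hC' hCα)
      (rowSupport A H.verts a)
    refine hrow.trans ?_
    have hcard : 2 * (rowSupport A H.verts a \ H.verts).card ≤ alpha n p := by
      have h1 := Finset.card_le_card (rowSupport_sdiff_subset A H.verts ∅ a)
      rw [Finset.sdiff_empty, Finset.union_empty] at h1
      omega
    have hcard' : ((12 * ℓ * alpha n p + (rowSupport A H.verts a \ H.verts).card : ℕ) : ℝ) ≤
        12.5 * ℓ * alpha n p := by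
      have h1 : (2 : ℝ) * (rowSupport A H.verts a \ H.verts).card ≤ alpha n p := by
        exact_mod_cast hcard
      have h2 : (alpha n p : ℝ) ≤ ℓ * alpha n p :=
        le_mul_of_one_le_left (Nat.cast_nonneg _) hℓ0
      push_cast
      linarith
    have hm : (rowSupport A H.verts a ∩ H.verts).card + 1 ≤ n :=
      card_add_one_le hA hA0 Finset.inter_subset_right
    refine (mul_le_mul (one_add_pow_le_exp hp0.le _)
      (add_one_rpow_le_exp hm (by linarith)) (by positivity) (by positivity)).trans ?_
    rw [← Real.exp_add, Real.exp_le_exp]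
    have hlog0 : 0 ≤ Real.log n := by linarith
    have hI0 : 0 ≤ I := by linarith
    -- Relative to I(log n)², the leftover vertices give at most 12.5 · 65/(128 · 7) < 1 and the
    -- branching gives 5; the sum is below 6 ≤ 2(ℓ + 2).
    have i1 := mul_le_mul_of_nonneg_left hcard' hp0.le
    have i2 := mul_le_mul_of_nonneg_left hpα (by positivity : (0 : ℝ) ≤ 12.5 * ℓ)
    have i3 := mul_le_mul_of_nonneg_right hinvge hlog0
    have i4 := mul_le_mul_of_nonneg_right hlog (mul_nonneg hI0 hlog0)
    have i5 := mul_le_mul_of_nonneg_right hℓ0 (mul_nonneg hlog0 (mul_nonneg hI0 hlog0))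
    linarith
  · have : (2 : ℝ) * A.card = alpha n p := by exact_mod_cast hAα
    rw [← this]
    ring_nf

theorem lemma3p6 (ℓ n : ℕ) (hℓ : 1 ≤ ℓ) (p : ℝ) (hp0 : 0 < p)
    (hp : p ≤ 1 / ((2 : ℝ) ^ 7 * ℓ) ^ ℓ)
    (H : OrientedGraph (Fin n)) (A : Finset (Fin n)) (hAH : Disjoint A H.verts)
    (hA : 2 * A.card = alpha n p) :
    (∀ r : ℕ, 2 ≤ r → r ≤ ℓ → ∀ B X : Finset (Fin n), IsFrame ℓ p r A H.verts B X →
      expectExt A H.underlying p (fun G =>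
        ((denseExtensions ℓ p (r - 1) G (OrientedGraph.empty (Fin n)) ∩
          sparseExtensions ℓ p r G H B X).ncard : ℝ)) ≤
        Real.exp (9 * (alpha n p : ℝ) * p ^ (-(1 / (ℓ : ℝ))) * Real.log n)) ∧
    expectExt A H.underlying p (fun G => ((denseExtensions ℓ p ℓ G H).ncard : ℝ)) ≤
      Real.exp ((alpha n p : ℝ) * ((ℓ : ℝ) + 2) * p ^ (-(1 / (ℓ : ℝ))) * Real.log n ^ 2) := by
  refine ⟨fun r hr hrℓ B X hframe => ?_, expectExt_dense_le hℓ hp0 hp H A hAH hA⟩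
  obtain ⟨k, rfl⟩ : ∃ k, r = k + 1 := ⟨r - 1, by omega⟩
  exact expectExt_dense_inter_sparse_le (by omega) hrℓ hp0 hp H A B X hframe
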